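/- **(A)** Let $\mathcal A$ be a unital C*-algebra. A weight is a map $\tau_0:\mathcal A_+\to[0,\infty]$ with $\tau_0(A+B)=\tau_0(A)+\tau_0(B)$ and $\tau_0(\lambda A)=\lambda\tau_0(A)$ for $A,B\in\mathcal A_+$, $\lambda\ge 0$ (with $0\cdot\infty=0$). Its semicontinuous regularization is $$\tau(A):=\sup\{\psi(A):\psi\in\mathcal A^*_+,\ \psi\le\tau_0 \text{ on }\mathcal A_+\},\qquad A\in\mathcal A_+ .$$ For every weight $\tau_0$: $\tau$ is a lower semicontinuous weight; $\tau=\tau_0$ if and only if $\tau_0$ is lower semicontinuous; and $\tau(A)<\infty$ whenever $\tau_0(A)<\infty$. Let $\mathcal A_0\subset\mathcal A$ be a dense *-subalgebra. Call $U$ a $\delta$-unitary if $\|U^*U-1\|<\delta$ and $\|UU^*-1\|<\delta$, and call a weight $\sigma$ $\varepsilon$-invariant under $\delta$-unitaries of $\mathcal A_0$ if for every $\varepsilon\in(0,1)$ there is $\delta>0$ such that $(1-\varepsilon)\sigma(A)\le\sigma(UAU^*)\le(1+\varepsilon)\sigma(A)$ for all $\delta$-unitaries $U\in\mathcal A_0$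 and all $A\in\mathcal A_+$. If $\tau_0$ has this property, then so does $\tau$, and $\tau$ is a trace on $\mathcal A$: setting $\mathcal J_+:=\{A\in\mathcal A_+:\tau(A)<\infty\}$, the linear span $\mathcal J$ of $\mathcal J_+$ is a two-sided ideal of $\mathcal A$, $\tau$ extends uniquely to a linear functional on $\mathcal J$, and $\tau(AB)=\tau(BA)$ for all $A\in\mathcal J$, $B\in\mathcal A$. **(B)** Let $M$ be a metric space with distance $d$ in which closed bounded sets are compact, with a Borel measure $\mathrm{vol}$ that is finite on compact sets (for instance a complete Riemannian manifold with its Riemannian distance and volume), and let $F$ be a finite-dimensional Hermitian vector bundle over $M$. Let $L^2(F)$ be the Hilbert space of square-integrable sections, and $E_\Omega$ the multiplication by the characteristic function of a Borel set $\Omega$. Put $K(r):=\{x: d(x,K)\le r\}$ and $K(-r):=\overline{M\setminus (M\setminus K)(r)}$ for $r>0$. A bounded operator $T$ on $L^2(F)$ has finite propagation if for some $u>0$ one has $\operatorname{supp}Tf\subset K(u)$ whenever $K$ is compact and $\operatorname{supp}f\subset K$; the finite propagation operators form a unital *-algebra $\mathcal A_0(F)$, and its norm closure $\mathcal A(F)$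 is the C*-algebra of almost local operators. Let $\mathcal K=\{K_n\}$ be a regular exhaustion of $M$: an increasing sequence of compact sets with union $M$ and $\mathrm{vol}(K_n(r))/\mathrm{vol}(K_n(-r))\to1$ for every $r>0$. Let $\omega$ be a state on $\ell^\infty(\mathbb N)$ that vanishes on null sequences. For $T\ge0$ put $\mu_T(\Omega)=\mathrm{Tr}(E_\Omega TE_\Omega)$, and let $\mathcal J_{0+}$ be the set of bounded operators $T\ge0$ such that $\mu_T(C)<\infty$ for all compact $C$; for some $c>0$, $\mu_T(K_n)\le c\,\mathrm{vol}(K_n)$ for all large $n$; and $\mu_T(K_n(r_1)\setminus K_n(-r_2))/\mathrm{vol}(K_n)\to0$ for all $r_1,r_2>0$. For $T\in\mathcal A(F)_+$ let Roe's functional be $\varphi(T)=\omega\big(\{\mu_T(K_n)/\mathrm{vol}(K_n)\}_n\big)$ if $T\in\mathcal J_{0+}$ and $\varphi(T)=\infty$ otherwise. Then $\varphi$ is a weight on $\mathcal A(F)$; its semicontinuous regularization $\tau$ is a lower semicontinuous weight and a trace in the sense of (A); and the semifinite regularization of $\tau$, $$\mathrm{Tr}_{\mathcal K}(A):=\sup\{\tau(B):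 0\le B\le A,\ \tau(B)<\infty\},\qquad A\in\mathcal A(F)_+,$$ is a lower semicontinuous weight and a trace in the sense of (A), it is semifinite, i.e. $\mathrm{Tr}_{\mathcal K}(A)=\sup\{\mathrm{Tr}_{\mathcal K}(B):0\le B\le A,\ \mathrm{Tr}_{\mathcal K}(B)<\infty\}$ for all $A\in\mathcal A(F)_+$, and $\mathrm{Tr}_{\mathcal K}\le\tau$, with equality wherever $\tau$ is finite. -/

import Mathlib

open MeasureTheory Filter Topology Bundle Set
open scoped ENNReal NNReal ComplexOrder InnerProductSpace

namespace RoeTrace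

noncomputable section

/-! ### Weights on the positive cone of a unital C*-algebra -/

section Weights

variable {A : Type*} [CStarAlgebra A] [PartialOrder A] [StarOrderedRing A]

/-- The positive cone `A₊`. -/
abbrev PosCone (A : Type*) [Zero A] [LE A] : Type _ := {a : A // 0 ≤ a}

/-- `u a u*` as an element of the positive cone. -/
def adConj (u : A) (a : PosCone A) : PosCone A :=
  ⟨u * a.1 * star u, star_right_conjugate_nonneg a.2 u⟩

/-- `r a` as an element of the positive cone, for `r ≥ 0`. -/
def posSMul (r : ℝ≥0) (a : PosCone A) : PosCone A :=
  ⟨(r : ℝ) • a.1, smul_nonneg r.2 a.2⟩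

/-- A weight: an additive, positively homogeneous functional `A₊ → [0,∞]`
(with `0 * ∞ = 0`, so that a weight vanishes at `0`). -/
structure IsWeight (τ : PosCone A → ℝ≥0∞) : Prop where
  map_add : ∀ a b : PosCone A, τ (a + b) = τ a + τ b
  map_smul : ∀ (r : ℝ≥0) (a : PosCone A), τ (posSMul r a) = r * τ a

/-- `δ`-unitaries. -/
def IsDeltaUnitary (δ : ℝ) (u : A) : Prop :=
  ‖star u * u - 1‖ < δ ∧ ‖u * star u - 1‖ < δ

/-- `ε`-invariance of `τ` under the `δ`-unitaries of `A₀`. -/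
def IsEpsInvariant (A₀ : NonUnitalStarSubalgebra ℂ A) (τ : PosCone A → ℝ≥0∞) : Prop :=
  ∀ ε : ℝ, 0 < ε → ε < 1 → ∃ δ : ℝ, 0 < δ ∧
    ∀ u ∈ A₀, IsDeltaUnitary δ u → ∀ a : PosCone A,
      ENNReal.ofReal (1 - ε) * τ a ≤ τ (adConj u a) ∧
        τ (adConj u a) ≤ ENNReal.ofReal (1 + ε) * τ a

/-- The semicontinuous regularization of `τ₀`: the supremum of the positive functionals that
are dominated by `τ₀` on `A₊`. -/
def semicontReg (τ₀ : PosCone A → ℝ≥0∞) (a : PosCone A) : ℝ≥0∞ :=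
  ⨆ (ψ : A →ₚ[ℂ] ℂ) (_ : ∀ b : PosCone A, ENNReal.ofReal (ψ b.1).re ≤ τ₀ b),
    ENNReal.ofReal (ψ a.1).re

/-- The linear span `J` of `J₊ = {a ∈ A₊ : τ a < ∞}`. -/
def domainSpan (τ : PosCone A → ℝ≥0∞) : Submodule ℂ A :=
  Submodule.span ℂ {a : A | ∃ h : 0 ≤ a, τ ⟨a, h⟩ < ∞}

/-- The linear functional `f` on `J` extends `τ` (from `J₊`). -/
def Extends (τ : PosCone A → ℝ≥0∞) (f : domainSpan τ →ₗ[ℂ] ℂ) : Prop :=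
  ∀ (a : PosCone A) (h : τ a < ∞),
    f ⟨a.1, Submodule.subset_span ⟨a.2, h⟩⟩ = ((τ a).toReal : ℂ)

/-- `τ` is a trace: the span `J` of its domain is a two-sided ideal, `τ` extends (in one and only
one way) to a linear functional on `J`, and that extension satisfies `τ(ab) = τ(ba)` for `a ∈ J`
and all `b`. -/
structure IsTracial (τ : PosCone A → ℝ≥0∞) : Prop where
  mul_mem_right : ∀ a ∈ domainSpan τ, ∀ b : A, a * b ∈ domainSpan τ
  mul_mem_left : ∀ a ∈ domainSpan τ, ∀ b : A, b * a ∈ domainSpan τ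
  existsUnique_extension : ∃! f : domainSpan τ →ₗ[ℂ] ℂ, Extends τ f
  trace_comm : ∀ f : domainSpan τ →ₗ[ℂ] ℂ, Extends τ f →
    ∀ (a : A) (ha : a ∈ domainSpan τ) (b : A),
      f ⟨a * b, mul_mem_right a ha b⟩ = f ⟨b * a, mul_mem_left a ha b⟩

/-- The semifinite regularization: the supremum of `τ` over the smaller elements of its domain. -/
def semifiniteReg (τ : PosCone A → ℝ≥0∞) (a : PosCone A) : ℝ≥0∞ :=
  ⨆ (b : PosCone A) (_ : b ≤ a) (_ : τ b < ∞), τ b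

/-- `τ` is semifinite: `τ a = sup {τ b : 0 ≤ b ≤ a, τ b < ∞}`. -/
def IsSemifinite (τ : PosCone A → ℝ≥0∞) : Prop :=
  ∀ a : PosCone A, τ a = ⨆ (b : PosCone A) (_ : b ≤ a) (_ : τ b < ∞), τ b

end Weights

/-- A closed *-subalgebra of a C*-algebra, with the order of the big algebra, is a star-ordered
ring. -/
theorem starOrderedRing_of_isClosed {A : Type*} [CStarAlgebra A] [PartialOrder A]
    [StarOrderedRing A] (S : StarSubalgebra ℂ A) (hS : IsClosed (S : Set A)) :
    StarOrderedRing S := by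
  have := hS
  refine StarOrderedRing.of_nonneg_iff' (fun {x y} h z => ?_) (fun x => ⟨fun hx => ?_, ?_⟩)
  · change (z : A) + x ≤ z + y
    gcongr
  · have hx' : (0 : A) ≤ x := hx
    have h1 : IsSelfAdjoint x := Subtype.ext (IsSelfAdjoint.of_nonneg hx')
    have h2 : QuasispectrumRestricts x ContinuousMap.realToNNReal := by
      rw [quasispectrumRestricts_iff_spectrumRestricts, SpectrumRestricts.nnreal_iff]
      intro r hr
      have hr' : (algebraMap ℝ ℂ r) ∈ spectrum ℂ x := (spectrum.algebraMap_mem_iff ℂ).2 hr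
      rw [StarSubalgebra.spectrum_eq S, spectrum.algebraMap_mem_iff] at hr'
      exact spectrum_nonneg_of_nonneg hx' hr'
    obtain ⟨s, hs, -, h⟩ := CFC.exists_sqrt_of_isSelfAdjoint_of_quasispectrumRestricts h1 h2
    exact ⟨s, by rw [hs.star_eq, h]⟩
  · rintro ⟨s, rfl⟩
    exact star_mul_self_nonneg (s : A)

/-! ### The Hilbert space of a Hermitian bundle and almost local operators -/

section Sections

set_option linter.unusedSectionVars false

variable {M : Type*} [MetricSpace M] [ProperSpace M] [MeasurableSpace M] [BorelSpace M]
variable (V : Type*) [NormedAddCommGroup V] [NormedSpace ℂ V] [FiniteDimensional ℂ V]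
  (F : M → Type*) [TopologicalSpace (TotalSpace V F)]
  [∀ x, NormedAddCommGroup (F x)] [∀ x, InnerProductSpace ℂ (F x)]
  [FiberBundle V F] [VectorBundle ℂ V F]

/-- The inner products on the fibres form a (continuous) Hermitian metric on the bundle: by
polarization, this is continuity of the norm on the total space. -/
class IsHermitianBundle : Prop where
  continuous_norm : Continuous fun p : TotalSpace V F => ‖p.2‖

/-- Measurable sections: measurable in every local trivialization. -/
def IsMeasurableSection (s : ∀ x, F x) : Prop :=
  ∀ (e : Trivialization V (π V F)) [MemTrivializationAtlas e],
    StronglyMeasurable fun x => e.linearMapAt ℂ x (s x)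

variable {V F}

theorem IsMeasurableSection.add {s t : ∀ x, F x} (hs : IsMeasurableSection V F s)
    (ht : IsMeasurableSection V F t) : IsMeasurableSection V F (s + t) := fun e _ => by
  simpa [Function.comp_def, Pi.add_def] using (hs e).add (ht e)

theorem IsMeasurableSection.smul {s : ∀ x, F x} (c : ℂ) (hs : IsMeasurableSection V F s) :
    IsMeasurableSection V F (c • s) := fun e _ => by
  simpa [Pi.smul_def] using (hs e).const_smul c

theorem IsMeasurableSection.norm [IsHermitianBundle V F] {s : ∀ x, F x}
    (hs : IsMeasurableSection V F s) : Measurable fun x => ‖s x‖ := by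
  obtain ⟨T, hT, hcov⟩ := TopologicalSpace.countable_cover_nhds
    (fun x : M => (trivializationAt V F x).open_baseSet.mem_nhds (mem_baseSet_trivializationAt V F x))
  have key : ∀ x : M, Measurable
      ((trivializationAt V F x).baseSet.domRestrict fun y => ‖s y‖) := fun x => by
    set e := trivializationAt V F x
    have hc : Continuous fun p : e.baseSet × V => ‖e.symm p.1 p.2‖ :=
      (IsHermitianBundle.continuous_norm (V := V) (F := F)).comp
        (e.continuousOn_symm.comp_continuous
          (f := fun p : e.baseSet × V => ((p.1 : M), p.2)) (by fun_prop)
          (fun p => ⟨p.1.2, mem_univ _⟩))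
    have hm : StronglyMeasurable fun y : e.baseSet => (y, e.linearMapAt ℂ (y : M) (s y)) :=
      stronglyMeasurable_id.prodMk ((hs e).comp_measurable measurable_subtype_coe)
    have := (hc.comp_stronglyMeasurable hm).measurable
    convert this using 2 with y
    change ‖s y‖ = ‖e.symm (y : M) (e.linearMapAt ℂ (y : M) (s y))‖
    rw [e.symm_linearMapAt y.2]
  intro B hB
  have : (fun x => ‖s x‖) ⁻¹' B = ⋃ x ∈ T, Subtype.val ''
      (((trivializationAt V F x).baseSet.domRestrict fun y => ‖s y‖) ⁻¹' B) := by
    ext y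
    have : y ∈ ⋃ x ∈ T, (trivializationAt V F x).baseSet := hcov ▸ mem_univ y
    simp only [mem_iUnion] at this ⊢
    constructor
    · intro h
      obtain ⟨x, hx, hy⟩ := this
      exact ⟨x, hx, ⟨y, hy⟩, h, rfl⟩
    · rintro ⟨x, hx, y, h, rfl⟩
      exact h
  rw [this]
  exact MeasurableSet.biUnion hT fun x _ =>
    (trivializationAt V F x).open_baseSet.measurableSet.subtype_image (key x hB)

theorem IsMeasurableSection.inner [IsHermitianBundle V F] {s t : ∀ x, F x}
    (hs : IsMeasurableSection V F s) (ht : IsMeasurableSection V F t) :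
    Measurable fun x => ⟪s x, t x⟫_ℂ := by
  have h : ∀ c : ℂ, Measurable fun x => ‖s x + c • t x‖ := fun c => (hs.add (ht.smul c)).norm
  have h1 := h 1
  have h2 := h (-1)
  have h3 := h Complex.I
  have h4 := h (-Complex.I)
  simp only [one_smul, neg_smul, ← sub_eq_add_neg] at h1 h2 h3 h4
  simp only [inner_eq_sum_norm_sq_div_four]
  simp only [RCLike.I_to_complex]
  fun_prop


variable (V F) in
/-- The square-integrable measurable sections. -/
def sqIntegrableSections [IsHermitianBundle V F] (vol : Measure M) :
    Submodule ℂ (∀ x, F x) where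
  carrier := {s | IsMeasurableSection V F s ∧ MemLp (fun x => ‖s x‖) 2 vol}
  zero_mem' := ⟨fun e _ => by simpa using stronglyMeasurable_const, by simp⟩
  add_mem' := fun {s t} hs ht => ⟨hs.1.add ht.1,
    (hs.2.add ht.2).mono (hs.1.add ht.1).norm.aestronglyMeasurable (.of_forall fun x => by
      simpa using (norm_add_le (s x) (t x)).trans (le_abs_self _))⟩
  smul_mem' := fun c s hs => ⟨hs.1.smul c, by
    simpa [norm_smul] using hs.2.const_mul ‖c‖⟩

/-- The square-integrable measurable sections as a type of their own, which is going to carry the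
`L²` seminorm. -/
def PreL2 (V : Type*) [NormedAddCommGroup V] [NormedSpace ℂ V] [FiniteDimensional ℂ V]
    (F : M → Type*) [TopologicalSpace (TotalSpace V F)]
    [∀ x, NormedAddCommGroup (F x)] [∀ x, InnerProductSpace ℂ (F x)]
    [FiberBundle V F] [VectorBundle ℂ V F] [IsHermitianBundle V F] (vol : Measure M) : Type _ :=
  sqIntegrableSections V F vol

section PreL2

variable [IsHermitianBundle V F] {vol : Measure M}

instance : AddCommGroup (PreL2 V F vol) :=
  inferInstanceAs (AddCommGroup (sqIntegrableSections V F vol))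

instance : Module ℂ (PreL2 V F vol) :=
  inferInstanceAs (Module ℂ (sqIntegrableSections V F vol))

theorem integrable_inner (s t : PreL2 V F vol) :
    Integrable (fun x => ⟪s.1 x, t.1 x⟫_ℂ) vol :=
  (s.2.2.integrable_mul t.2.2).mono (s.2.1.inner t.2.1).aestronglyMeasurable
    (.of_forall fun x => (norm_inner_le_norm _ _).trans (by simp))

/-- The scalar product `∫ ⟪s x, t x⟫ dvol(x)`. -/
instance instCore : PreInnerProductSpace.Core ℂ (PreL2 V F vol) where
  inner s t := ∫ x, ⟪s.1 x, t.1 x⟫_ℂ ∂vol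
  conj_inner_symm s t := by
    change starRingEnd ℂ (∫ x, _ ∂vol) = _
    rw [← integral_conj]
    simp
  re_inner_nonneg s := by
    rw [← integral_re (integrable_inner s s)]
    exact integral_nonneg fun x => inner_self_nonneg
  add_left s t u := by
    change ∫ x, ⟪s.1 x + t.1 x, u.1 x⟫_ℂ ∂vol = _
    simp only [inner_add_left]
    exact integral_add (integrable_inner s u) (integrable_inner t u)
  smul_left s t c := by
    change ∫ x, ⟪c • s.1 x, t.1 x⟫_ℂ ∂vol = _
    simp only [inner_smul_left]
    exact integral_const_mul _ _

instance : SeminormedAddCommGroup (PreL2 V F vol) :=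
  InnerProductSpace.Core.toSeminormedAddCommGroup (𝕜 := ℂ)

instance : InnerProductSpace ℂ (PreL2 V F vol) := InnerProductSpace.ofCore instCore

theorem inner_def (s t : PreL2 V F vol) : ⟪s, t⟫_ℂ = ∫ x, ⟪s.1 x, t.1 x⟫_ℂ ∂vol := rfl

theorem norm_sq_eq (s : PreL2 V F vol) : ‖s‖ ^ 2 = ∫ x, ‖s.1 x‖ ^ 2 ∂vol := by
  rw [← inner_self_eq_norm_sq (𝕜 := ℂ), inner_def, ← integral_re (integrable_inner s s)]
  simp only [inner_self_eq_norm_sq]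

end PreL2

/-- The Hilbert space `L²(F)`: the (Hausdorff) completion of the square-integrable sections, that
is, the square-integrable sections modulo almost everywhere equality. -/
abbrev L2 (V : Type*) [NormedAddCommGroup V] [NormedSpace ℂ V] [FiniteDimensional ℂ V]
    (F : M → Type*) [TopologicalSpace (TotalSpace V F)]
    [∀ x, NormedAddCommGroup (F x)] [∀ x, InnerProductSpace ℂ (F x)]
    [FiberBundle V F] [VectorBundle ℂ V F] [IsHermitianBundle V F] (vol : Measure M) : Type _ :=
  UniformSpace.Completion (PreL2 V F vol)

section Cutoff

variable [IsHermitianBundle V F] {vol : Measure M}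

open scoped Classical in
/-- Multiplication of a section by the characteristic function of `Ω`. -/
def cutoffSection (Ω : Set M) (s : ∀ x, F x) : ∀ x, F x := fun x => if x ∈ Ω then s x else 0

theorem cutoffSection_mem {Ω : Set M} (hΩ : MeasurableSet Ω) {s : ∀ x, F x}
    (hs : s ∈ sqIntegrableSections V F vol) :
    cutoffSection Ω s ∈ sqIntegrableSections V F vol := by
  classical
  have h : IsMeasurableSection V F (cutoffSection Ω s) := fun e _ => by
    have := (hs.1 e).indicator hΩ
    convert this using 2 with x
    by_cases hx : x ∈ Ω <;> simp [cutoffSection, hx]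
  refine ⟨h, hs.2.mono h.norm.aestronglyMeasurable (.of_forall fun x => ?_)⟩
  by_cases hx : x ∈ Ω <;> simp [cutoffSection, hx]

/-- Multiplication by the characteristic function of a Borel set, on square-integrable sections. -/
def preCutoff {Ω : Set M} (hΩ : MeasurableSet Ω) : PreL2 V F vol →L[ℂ] PreL2 V F vol :=
  LinearMap.mkContinuous
    { toFun := fun s => ⟨cutoffSection Ω s.1, cutoffSection_mem hΩ s.2⟩
      map_add' := fun s t => Subtype.ext <| funext fun x => by
        change cutoffSection Ω (s.1 + t.1) x = cutoffSection Ω s.1 x + cutoffSection Ω t.1 x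
        by_cases hx : x ∈ Ω <;> simp [cutoffSection, hx]
      map_smul' := fun c s => Subtype.ext <| funext fun x => by
        change cutoffSection Ω (c • s.1) x = c • cutoffSection Ω s.1 x
        by_cases hx : x ∈ Ω <;> simp [cutoffSection, hx] } 1 (fun s => by
    rw [one_mul]
    refine (sq_le_sq₀ (norm_nonneg _) (norm_nonneg _)).1 ?_
    rw [norm_sq_eq, norm_sq_eq]
    refine integral_mono (cutoffSection_mem hΩ s.2).2.integrable_sq s.2.2.integrable_sq fun x => ?_
    change ‖cutoffSection Ω s.1 x‖ ^ 2 ≤ ‖s.1 x‖ ^ 2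
    by_cases hx : x ∈ Ω <;> simp [cutoffSection, hx])

theorem preCutoff_apply {Ω : Set M} (hΩ : MeasurableSet Ω) (s : PreL2 V F vol) (x : M) :
    (preCutoff hΩ s).1 x = cutoffSection Ω s.1 x := rfl

open scoped Classical in
/-- The projection `E_Ω` of `L²(F)`: multiplication by the characteristic function of the Borel
set `Ω` (only Borel sets matter; the value is `0` for other sets). -/
def cutoff (V : Type*) [NormedAddCommGroup V] [NormedSpace ℂ V] [FiniteDimensional ℂ V]
    (F : M → Type*) [TopologicalSpace (TotalSpace V F)]
    [∀ x, NormedAddCommGroup (F x)] [∀ x, InnerProductSpace ℂ (F x)]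
    [FiberBundle V F] [VectorBundle ℂ V F] [IsHermitianBundle V F] (vol : Measure M)
    (Ω : Set M) : L2 V F vol →L[ℂ] L2 V F vol :=
  if hΩ : MeasurableSet Ω then (preCutoff hΩ).completion else 0

theorem cutoff_coe {Ω : Set M} (hΩ : MeasurableSet Ω) (s : PreL2 V F vol) :
    cutoff V F vol Ω (s : L2 V F vol) = (preCutoff hΩ s : PreL2 V F vol) := by
  rw [cutoff, dif_pos hΩ, ContinuousLinearMap.completion_apply_coe]

theorem norm_preCutoff_le {Ω : Set M} (hΩ : MeasurableSet Ω) (s : PreL2 V F vol) :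
    ‖preCutoff hΩ s‖ ≤ ‖s‖ := by
  simpa using LinearMap.mkContinuous_norm_le _ zero_le_one _ |> fun h =>
    (preCutoff hΩ (V := V) (F := F) (vol := vol)).le_of_opNorm_le h s

theorem norm_cutoff_le {Ω : Set M} (hΩ : MeasurableSet Ω) (f : L2 V F vol) :
    ‖cutoff V F vol Ω f‖ ≤ ‖f‖ := by
  induction f using UniformSpace.Completion.induction_on with
  | hp => exact isClosed_le (by fun_prop) (by fun_prop)
  | ih s =>
    rw [cutoff_coe hΩ, UniformSpace.Completion.norm_coe, UniformSpace.Completion.norm_coe]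
    exact norm_preCutoff_le hΩ s

theorem cutoff_cutoff {Ω Ω' : Set M} (hΩ : MeasurableSet Ω) (hΩ' : MeasurableSet Ω')
    (f : L2 V F vol) :
    cutoff V F vol Ω (cutoff V F vol Ω' f) = cutoff V F vol (Ω ∩ Ω') f := by
  induction f using UniformSpace.Completion.induction_on with
  | hp => exact isClosed_eq (by fun_prop) (by fun_prop)
  | ih s =>
    rw [cutoff_coe hΩ', cutoff_coe hΩ, cutoff_coe (hΩ.inter hΩ')]
    congr 1
    refine Subtype.ext (funext fun x => ?_)
    by_cases h : x ∈ Ω <;> by_cases h' : x ∈ Ω' <;>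
      simp [preCutoff_apply, cutoffSection, h, h']

theorem cutoff_add_compl {Ω : Set M} (hΩ : MeasurableSet Ω) (f : L2 V F vol) :
    cutoff V F vol Ω f + cutoff V F vol Ωᶜ f = f := by
  induction f using UniformSpace.Completion.induction_on with
  | hp => exact isClosed_eq (by fun_prop) (by fun_prop)
  | ih s =>
    rw [cutoff_coe hΩ, cutoff_coe hΩ.compl, ← UniformSpace.Completion.coe_add]
    congr 1
    refine Subtype.ext (funext fun x => ?_)
    change cutoffSection Ω s.1 x + cutoffSection Ωᶜ s.1 x = s.1 x
    by_cases h : x ∈ Ω <;> simp [cutoffSection, h]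

theorem inner_cutoff {Ω : Set M} (hΩ : MeasurableSet Ω) (f g : L2 V F vol) :
    ⟪cutoff V F vol Ω f, g⟫_ℂ = ⟪f, cutoff V F vol Ω g⟫_ℂ := by
  induction f, g using UniformSpace.Completion.induction_on₂ with
  | hp => exact isClosed_eq (by fun_prop) (by fun_prop)
  | ih s t =>
    rw [cutoff_coe hΩ, cutoff_coe hΩ, UniformSpace.Completion.inner_coe,
      UniformSpace.Completion.inner_coe, inner_def, inner_def]
    refine integral_congr_ae (.of_forall fun x => ?_)
    by_cases h : x ∈ Ω <;> simp [preCutoff_apply, cutoffSection, h]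

theorem tendsto_cutoff {U : ℕ → Set M} (hU : ∀ n, MeasurableSet (U n)) (hm : Monotone U)
    (f : L2 V F vol) :
    Tendsto (fun n => cutoff V F vol (U n) f) atTop (𝓝 (cutoff V F vol (⋃ n, U n) f)) := by
  have hW := MeasurableSet.iUnion hU
  have key : ∀ s : PreL2 V F vol,
      Tendsto (fun n => preCutoff (hU n) s - preCutoff hW s) atTop (𝓝 0) := fun s => by
    rw [tendsto_zero_iff_norm_tendsto_zero]
    have : Tendsto (fun n => ‖preCutoff (hU n) s - preCutoff hW s‖ ^ 2) atTop (𝓝 0) := by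
      simp only [norm_sq_eq]
      rw [← integral_zero M ℝ (μ := vol)]
      refine tendsto_integral_of_dominated_convergence (fun x => ‖s.1 x‖ ^ 2)
        (fun n => (preCutoff (hU n) s - preCutoff hW s).2.2.integrable_sq.aestronglyMeasurable)
        s.2.2.integrable_sq (fun n => .of_forall fun x => ?_) (.of_forall fun x => ?_)
      · change ‖‖cutoffSection (U n) s.1 x - cutoffSection (⋃ n, U n) s.1 x‖ ^ 2‖ ≤ _
        by_cases h : x ∈ U n
        · have h' : x ∈ ⋃ n, U n := mem_iUnion.2 ⟨n, h⟩
          simp [cutoffSection, h, h']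
        · by_cases h' : x ∈ ⋃ n, U n <;> simp only [cutoffSection, h, h', if_true, if_false] <;> simp
      · change Tendsto (fun n => ‖cutoffSection (U n) s.1 x - cutoffSection (⋃ n, U n) s.1 x‖ ^ 2)
          atTop (𝓝 0)
        refine tendsto_const_nhds.congr' ?_
        by_cases h' : x ∈ ⋃ n, U n
        · obtain ⟨n, hn⟩ := mem_iUnion.1 h'
          filter_upwards [eventually_ge_atTop n] with k hk
          have : x ∈ U k := hm hk hn
          simp only [cutoffSection, h', this, if_true]
          simp
        · refine .of_forall fun n => ?_
          have : x ∉ U n := fun h => h' (mem_iUnion.2 ⟨n, h⟩)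
          simp only [cutoffSection, h', this, if_false]
          simp
    have h := this.sqrt
    simpa [Real.sqrt_sq] using h
  rw [Metric.tendsto_atTop]
  intro ε hε
  obtain ⟨s, hs⟩ := UniformSpace.Completion.denseRange_coe.exists_dist_lt f (ε := ε / 3) (by positivity)
  obtain ⟨N, hN⟩ := Metric.tendsto_atTop.1 (key s) (ε / 3) (by positivity)
  refine ⟨N, fun n hn => ?_⟩
  have h1 := hN n hn
  rw [dist_eq_norm, sub_zero, ← UniformSpace.Completion.norm_coe, UniformSpace.Completion.coe_sub,
    ← cutoff_coe, ← cutoff_coe] at h1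
  rw [dist_eq_norm] at hs ⊢
  generalize (s : L2 V F vol) = g at h1 hs
  have h2 := norm_cutoff_le (hU n) (f - g)
  have h3 := norm_cutoff_le hW (f - g)
  have : cutoff V F vol (U n) f - cutoff V F vol (⋃ n, U n) f =
      cutoff V F vol (U n) (f - g) + (cutoff V F vol (U n) g - cutoff V F vol (⋃ n, U n) g)
        - cutoff V F vol (⋃ n, U n) (f - g) := by
    simp only [map_sub]; abel
  rw [this]
  have h4 := norm_sub_le (cutoff V F vol (U n) (f - g) +
    (cutoff V F vol (U n) g - cutoff V F vol (⋃ n, U n) g)) (cutoff V F vol (⋃ n, U n) (f - g))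
  have h5 := norm_add_le (cutoff V F vol (U n) (f - g))
    (cutoff V F vol (U n) g - cutoff V F vol (⋃ n, U n) g)
  linarith

/-- The (essential) support of an element of `L²(F)`. -/
def essSupport (f : L2 V F vol) : Set M :=
  {x | ∀ U : Set M, IsOpen U → x ∈ U → cutoff V F vol U f ≠ 0}

theorem cutoff_iUnion_eq_zero {U : ℕ → Set M} (hU : ∀ n, MeasurableSet (U n))
    (f : L2 V F vol) (h : ∀ n, cutoff V F vol (U n) f = 0) :
    cutoff V F vol (⋃ n, U n) f = 0 := by
  have hA : ∀ n, MeasurableSet (accumulate U n) := fun n => by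
    rw [accumulate_def]
    exact MeasurableSet.biUnion (to_countable _) fun i _ => hU i
  have key : ∀ n, cutoff V F vol (accumulate U n) f = 0 := by
    intro n
    induction n with
    | zero => rw [accumulate_zero_nat]; exact h 0
    | succ n ih =>
      have hs := hA (n + 1)
      rw [← cutoff_add_compl (hA n) (cutoff V F vol (accumulate U (n + 1)) f),
        cutoff_cutoff (hA n) hs, cutoff_cutoff (hA n).compl hs,
        show accumulate U n ∩ accumulate U (n + 1) = accumulate U n from
          inter_eq_left.2 (monotone_accumulate n.le_succ), ih,
        show (accumulate U n)ᶜ ∩ accumulate U (n + 1) = (accumulate U n)ᶜ ∩ U (n + 1) by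
          rw [accumulate_succ, inter_union_distrib_left]; simp,
        ← cutoff_cutoff (hA n).compl (hU _), h, map_zero, add_zero]
  rw [← iUnion_accumulate]
  refine tendsto_nhds_unique (tendsto_cutoff hA monotone_accumulate f) ?_
  simp only [key]
  exact tendsto_const_nhds

theorem cutoff_empty (f : L2 V F vol) : cutoff V F vol ∅ f = 0 := by
  induction f using UniformSpace.Completion.induction_on with
  | hp => exact isClosed_eq (by fun_prop) (by fun_prop)
  | ih s =>
    rw [cutoff_coe .empty, ← UniformSpace.Completion.coe_zero]
    congr 1
    exact Subtype.ext (funext fun x => if_neg (notMem_empty x))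

theorem cutoff_eq_zero_of_subset {f : L2 V F vol} {Ω Ω' : Set M} (hΩ : MeasurableSet Ω)
    (hΩ' : MeasurableSet Ω') (hs : Ω ⊆ Ω') (h : cutoff V F vol Ω' f = 0) :
    cutoff V F vol Ω f = 0 := by
  rw [← inter_eq_left.2 hs, ← cutoff_cutoff hΩ hΩ', h, map_zero]

/-- `supp f ⊆ C` iff multiplication by the characteristic function of `M \ C` kills `f`. -/
theorem essSupport_subset_iff {f : L2 V F vol} {C : Set M} (hC : IsClosed C) :
    essSupport f ⊆ C ↔ cutoff V F vol Cᶜ f = 0 := by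
  constructor
  · intro h
    set S : Set (Set M) :=
      insert ∅ {B ∈ TopologicalSpace.countableBasis M | cutoff V F vol B f = 0}
    have hS : S.Countable :=
      ((TopologicalSpace.countable_countableBasis M).mono (sep_subset _ _)).insert _
    obtain ⟨U, hU⟩ := hS.exists_eq_range (insert_nonempty _ _)
    have hmem : ∀ n, U n ∈ S := fun n => hU ▸ mem_range_self n
    have hmeas : ∀ n, MeasurableSet (U n) := fun n => by
      rcases hmem n with h | h
      · rw [h]; exact .empty
      · exact (TopologicalSpace.isOpen_of_mem_countableBasis h.1).measurableSet
    have hzero : ∀ n, cutoff V F vol (U n) f = 0 := fun n => by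
      rcases hmem n with h | h
      · rw [h]; exact cutoff_empty f
      · exact h.2
    refine cutoff_eq_zero_of_subset hC.isOpen_compl.measurableSet (MeasurableSet.iUnion hmeas)
      (fun x hx => ?_) (cutoff_iUnion_eq_zero hmeas f hzero)
    have hx' : x ∉ essSupport f := fun h' => hx (h h')
    simp only [essSupport, mem_ofPred_eq, not_forall, not_not] at hx'
    obtain ⟨W, hW, hxW, hf⟩ := hx'
    obtain ⟨B, hB, hxB, hBW⟩ :=
      (TopologicalSpace.isBasis_countableBasis M).exists_subset_of_mem_open hxW hW
    have hBo := TopologicalSpace.isOpen_of_mem_countableBasis hB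
    have : B ∈ S :=
      Or.inr ⟨hB, cutoff_eq_zero_of_subset hBo.measurableSet hW.measurableSet hBW hf⟩
    rw [hU] at this
    obtain ⟨n, rfl⟩ := this
    exact mem_iUnion.2 ⟨n, hxB⟩
  · intro h x hx
    by_contra hxC
    exact hx Cᶜ hC.isOpen_compl hxC h

/-- Finite propagation: there is `u > 0` with `supp (A f) ⊆ Pen⁺(K, u) = {x : dist(x, K) ≤ u}`
whenever `K` is compact and `supp f ⊆ K`. -/
def HasFinitePropagation (A : L2 V F vol →L[ℂ] L2 V F vol) : Prop :=
  ∃ u : ℝ, 0 < u ∧ ∀ K : Set M, IsCompact K → ∀ f : L2 V F vol, essSupport f ⊆ K →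
    essSupport (A f) ⊆ Metric.cthickening u K

theorem hasFinitePropagation_star {A : L2 V F vol →L[ℂ] L2 V F vol}
    (hA : HasFinitePropagation A) : HasFinitePropagation (star A) := by
  obtain ⟨u, hu, h⟩ := hA
  refine ⟨u, hu, fun K hK f hf x hx => ?_⟩
  by_contra hxK
  obtain ⟨r, hr, hrL⟩ := Metric.nhds_basis_closedBall.mem_iff.1
    (Metric.isClosed_cthickening.isOpen_compl.mem_nhds hxK)
  refine hx (Metric.ball x r) Metric.isOpen_ball (Metric.mem_ball_self hr) ?_
  set L := Metric.closedBall x r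
  have hLc : IsCompact L := isCompact_closedBall x r
  have hBm : MeasurableSet (Metric.ball x r) := Metric.isOpen_ball.measurableSet
  set g := cutoff V F vol (Metric.ball x r) (star A f)
  have hg : essSupport g ⊆ L := by
    rw [essSupport_subset_iff hLc.isClosed,
      cutoff_cutoff hLc.isClosed.isOpen_compl.measurableSet hBm,
      show Lᶜ ∩ Metric.ball x r = ∅ from (disjoint_compl_left_iff_subset.2
        Metric.ball_subset_closedBall).inter_eq]
    exact cutoff_empty _
  have hAg := (essSupport_subset_iff Metric.isClosed_cthickening).1 (h L hLc g hg)
  have hKL : K ⊆ (Metric.cthickening u L)ᶜ := fun y hy hyL => by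
    obtain ⟨l, hl, hyl⟩ := hLc.exists_infEDist_eq_edist ⟨x, Metric.mem_closedBall_self hr.le⟩ y
    refine hrL hl (Metric.mem_cthickening_iff.2 ?_)
    calc Metric.infEDist l K ≤ edist l y := Metric.infEDist_le_edist_of_mem hy
      _ = Metric.infEDist y L := by rw [edist_comm, hyl]
      _ ≤ ENNReal.ofReal u := hyL
  have hKm := hK.isClosed.measurableSet
  have hKg : cutoff V F vol K (A g) = 0 := cutoff_eq_zero_of_subset hKm
    Metric.isClosed_cthickening.isOpen_compl.measurableSet hKL hAg
  have hfK : cutoff V F vol K f = f := by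
    have := cutoff_add_compl hKm f
    rwa [(essSupport_subset_iff hK.isClosed).1 hf, add_zero] at this
  rw [← inner_self_eq_zero (𝕜 := ℂ)]
  change ⟪g, g⟫_ℂ = 0
  calc ⟪g, g⟫_ℂ = ⟪cutoff V F vol (Metric.ball x r) g, star A f⟫_ℂ := (inner_cutoff hBm _ _).symm
    _ = ⟪g, star A f⟫_ℂ := by rw [cutoff_cutoff hBm hBm, inter_self]
    _ = ⟪A g, f⟫_ℂ := by
      rw [ContinuousLinearMap.star_eq_adjoint, ContinuousLinearMap.adjoint_inner_right]
    _ = 0 := by rw [← hfK, ← inner_cutoff hKm, hKg, inner_zero_left]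

variable (V F vol) in
/-- The *-algebra `𝒜₀(F)` of finite propagation operators. -/
def finitePropagation : StarSubalgebra ℂ (L2 V F vol →L[ℂ] L2 V F vol) where
  carrier := {A | HasFinitePropagation A}
  mul_mem' := by
    rintro A B ⟨u, hu, hA⟩ ⟨v, hv, hB⟩
    exact ⟨u + v, by positivity, fun K hK f hf =>
      (hA _ hK.cthickening _ (hB K hK f hf)).trans
        (Metric.cthickening_cthickening_subset hu.le hv.le K)⟩
  add_mem' := by
    rintro A B ⟨u, hu, hA⟩ ⟨v, hv, hB⟩
    refine ⟨max u v, lt_max_of_lt_left hu, fun K hK f hf => ?_⟩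
    have h1 := (hA K hK f hf).trans (Metric.cthickening_mono (le_max_left u v) K)
    have h2 := (hB K hK f hf).trans (Metric.cthickening_mono (le_max_right u v) K)
    rw [essSupport_subset_iff Metric.isClosed_cthickening] at h1 h2 ⊢
    rw [add_apply, map_add, h1, h2, add_zero]
  algebraMap_mem' := by
    refine fun c => ⟨1, one_pos, fun K hK f hf => ?_⟩
    have h1 := hf.trans (Metric.self_subset_cthickening (δ := 1) K)
    rw [essSupport_subset_iff Metric.isClosed_cthickening] at h1 ⊢
    rw [Algebra.algebraMap_eq_smul_one, smul_apply, map_smul,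
      one_apply_eq_self, h1, smul_zero]
  star_mem' := hasFinitePropagation_star

variable (V F vol) in
/-- The C*-algebra `𝒜(F)` of almost local operators: the norm closure of `𝒜₀(F)`. -/
def almostLocal : StarSubalgebra ℂ (L2 V F vol →L[ℂ] L2 V F vol) :=
  (finitePropagation V F vol).topologicalClosure

instance : IsClosed (almostLocal V F vol : Set (L2 V F vol →L[ℂ] L2 V F vol)) :=
  StarSubalgebra.isClosed_topologicalClosure _

instance : StarOrderedRing (almostLocal V F vol) :=
  starOrderedRing_of_isClosed _ inferInstance

end Cutoff

/-! ### Roe's functional -/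

/-- The trace of a positive bounded operator, in `[0,∞]`: the sum of the diagonal matrix
coefficients in a Hilbert basis (the sum does not depend on the basis). -/
def posTrace {H : Type*} [NormedAddCommGroup H] [InnerProductSpace ℂ H] [CompleteSpace H]
    (T : H →L[ℂ] H) : ℝ≥0∞ :=
  ∑' e : (exists_hilbertBasis ℂ H).choose, ENNReal.ofReal (⟪(e : H), T e⟫_ℂ).re

section Exhaustion

/-- `Pen⁻(K, r)`: the closure of `M \ Pen⁺(M \ K, r)`, where `Pen⁺(S, r)`, the set of points at
distance at most `r` from `S` (empty if `S` is empty), is `Metric.cthickening r S`. -/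
def innerPenumbra (r : ℝ) (K : Set M) : Set M := closure (Metric.cthickening r Kᶜ)ᶜ

/-- A regular exhaustion: an increasing sequence of compact sets `K n` with union `M`, such that
`vol (Pen⁺(K n, r)) / vol (Pen⁻(K n, r)) → 1` for all `r > 0`. -/
structure IsRegularExhaustion (vol : Measure M) (K : ℕ → Set M) : Prop where
  isCompact : ∀ n, IsCompact (K n)
  monotone : Monotone K
  iUnion_eq : ⋃ n, K n = univ
  tendsto_ratio : ∀ r : ℝ, 0 < r → Tendsto
    (fun n => vol (Metric.cthickening r (K n)) / vol (innerPenumbra r (K n))) atTop (𝓝 1)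

end Exhaustion

/-- `ω` is a state on `ℓ^∞(ℕ)` that vanishes on the sequences converging to `0`. -/
structure IsLimitState (ω : (BoundedContinuousFunction ℕ ℂ) →ₗ[ℂ] ℂ) : Prop where
  nonneg : ∀ a : BoundedContinuousFunction ℕ ℂ, (∀ n, 0 ≤ a n) → 0 ≤ ω a
  map_one : ω 1 = 1
  map_null : ∀ a : BoundedContinuousFunction ℕ ℂ, Tendsto a atTop (𝓝 0) → ω a = 0

open scoped Classical in
/-- `Lim_ω a = ω(a)` for a bounded real sequence `a` (and `0` if `a` is unbounded). -/
def limState (ω : (BoundedContinuousFunction ℕ ℂ) →ₗ[ℂ] ℂ) (a : ℕ → ℝ) : ℝ :=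
  if h : ∃ C : ℝ, ∀ n, ‖(a n : ℂ)‖ ≤ C then
    (ω (BoundedContinuousFunction.ofNormedAddCommGroupDiscrete
      (fun n => (a n : ℂ)) h.choose h.choose_spec)).re
  else 0

section Roe

variable [IsHermitianBundle V F] {vol : Measure M}

/-- `μ_T(Ω) = Tr(E_Ω T E_Ω)` for a positive operator `T` and a Borel set `Ω`. -/
def traceMeasure (T : L2 V F vol →L[ℂ] L2 V F vol) (Ω : Set M) : ℝ≥0∞ :=
  posTrace (cutoff V F vol Ω * T * cutoff V F vol Ω)

/-- The cone `𝒥₀₊` of positive, locally trace class operators `T` such that `μ_T(K n)` is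
asymptotically bounded by a multiple of `vol (K n)` and the boundary layers of the exhaustion
carry an asymptotically negligible part of `μ_T`. -/
structure MemRoeCone (K : ℕ → Set M) (T : L2 V F vol →L[ℂ] L2 V F vol) : Prop where
  nonneg : 0 ≤ T
  locallyTraceClass : ∀ C : Set M, IsCompact C → traceMeasure T C < ∞
  bounded : ∃ c : ℝ≥0, 0 < c ∧ ∀ᶠ n in atTop, traceMeasure T (K n) ≤ c * vol (K n)
  boundary : ∀ r₁ r₂ : ℝ, 0 < r₁ → 0 < r₂ → Tendsto
    (fun n => traceMeasure T (Metric.cthickening r₁ (K n) \ innerPenumbra r₂ (K n)) / vol (K n))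
    atTop (𝓝 0)

open scoped Classical in
/-- Roe's functional on positive operators: `Lim_ω (μ_T(K n) / vol (K n))` if `T ∈ 𝒥₀₊`, and `∞`
otherwise. -/
def roeFunctional (K : ℕ → Set M) (ω : (BoundedContinuousFunction ℕ ℂ) →ₗ[ℂ] ℂ)
    (T : L2 V F vol →L[ℂ] L2 V F vol) : ℝ≥0∞ :=
  if MemRoeCone K T then
    ENNReal.ofReal (limState ω fun n => (traceMeasure T (K n) / vol (K n)).toReal)
  else ∞

/-- The restriction of Roe's functional to the positive cone of `𝒜(F)`. -/
def roeWeight (K : ℕ → Set M) (ω : (BoundedContinuousFunction ℕ ℂ) →ₗ[ℂ] ℂ)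
    (T : PosCone (almostLocal V F vol)) : ℝ≥0∞ :=
  roeFunctional K ω (T.1 : L2 V F vol →L[ℂ] L2 V F vol)

/-- `Tr_𝒦`: the semifinite regularization of the semicontinuous regularization of Roe's
functional on `𝒜(F)`. -/
def roeTrace (K : ℕ → Set M) (ω : (BoundedContinuousFunction ℕ ℂ) →ₗ[ℂ] ℂ) :
    PosCone (almostLocal V F vol) → ℝ≥0∞ :=
  semifiniteReg (semicontReg (roeWeight K ω))

end Roe

end Sections

end

end RoeTrace

/-!
Everything about the semicontinuous regularization rests on one compression estimate
(`exists_compression`). For `b ≥ 0` put `g = f(b)` with `f(t) = √(t / (t + ε))`. If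
`0 ≤ c ≤ b + ε`, then `g c g ≤ b`, and `g c g` is close to `c` for small `ε`, with the same `g` for
all such `c`. This takes the place of the Riesz decomposition property, which fails in
noncommutative C*-algebras.

The Hahn–Banach theorem shows that the regularization `τ` of a weight `τ₀` at `a` is the supremum
over `ε > 0` of the infimum of `τ₀ b` over the `b ≥ 0` with `a ≤ b + ε`
(`le_semicontReg_of_forall`). Compressing `a` under `b` moves these `b` close to `a`, so that `τ` is
the largest lower semicontinuous minorant of `τ₀` (`exists_near_of_semicontReg_lt`); compressing two
summands at once makes `τ` additive (`le_semicontReg_add`). Estimates for `τ₀` along conjugations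
pass to `τ` by semicontinuity (`le_semicontReg_of_comp_le`). In particular `τ` inherits
`ε`-invariance, and since elements of the dense subalgebra approximate unitaries, `τ` is invariant
under all unitaries. A unitarily invariant weight is a trace because the unitaries span the algebra
(`isTracial_of_isUnitarilyInvariant`).

For a lower semicontinuous unitarily invariant weight, `τ(x* x) = τ(x x*)`, because `x* x` is the
limit of elements `x* (k h k) x` of the trace ideal, where `h = x x*` and `k = (h + ε)^{-1/2}`
(`map_star_mul_self_le`). This makes the semifinite regularization additive: an element
`b ≤ a₁ + a₂` of finite trace is a limit of sums `x₁* x₁ + x₂* x₂` with `x₁ x₁* ≤ a₁` and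
`x₂ x₂* ≤ a₂` (`semifiniteReg_add_le`). Its lower semicontinuity is again the compression estimate.

For Roe's functional `φ`, writing `T = Y Y*` gives `μ_T(Ω) = Σ ‖E_Ω Y e‖²` over a Hilbert basis
(`traceMeasure_mul_star`). An operator `x` of propagation `u` satisfies `E_Ω x = E_Ω x E_{Ω(u)}`, so
`μ_{x T x*}(Ω) ≤ ‖x‖² μ_T(Ω(u))`. The layer `K n (u) \ K n` is negligible on the cone `𝒥₀₊`, hence
`φ(x T x*) ≤ ‖x‖² φ(T)` whenever `φ(T)` is finite (`roeFunctional_conj_le`). This one-sided estimate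
already makes the regularization of `φ` unitarily invariant, so no lower estimate for
`φ(x T x*)` is needed, and the two general parts apply.
-/

namespace RoeTrace

/-! ### Compression under an almost majorant -/

section Compression

variable {A : Type*} [CStarAlgebra A] [PartialOrder A] [StarOrderedRing A]

theorem norm_mul_le_of_conj_le {d c : A} (hd : IsSelfAdjoint d) (hc : 0 ≤ c) {ε : ℝ}
    (h : ‖d * c * d‖ ≤ ε) : ‖d * c‖ ≤ √ε * √‖c‖ := by
  have hs : IsSelfAdjoint (CFC.sqrt c) := .of_nonneg (CFC.sqrt_nonneg c)
  have h1 : ‖d * CFC.sqrt c‖ ≤ √ε := by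
    refine Real.le_sqrt_of_sq_le ?_
    rw [sq, ← CStarRing.norm_self_mul_star, star_mul, hs.star_eq, hd.star_eq, ← mul_assoc,
      mul_assoc d, CFC.sqrt_mul_sqrt_self c]
    exact h
  have h2 : ‖CFC.sqrt c‖ = √‖c‖ := by
    have : ‖c‖ = ‖CFC.sqrt c‖ * ‖CFC.sqrt c‖ := by
      rw [← CStarRing.norm_self_mul_star, hs.star_eq, CFC.sqrt_mul_sqrt_self c]
    rw [this, Real.sqrt_mul_self (norm_nonneg _)]
  calc ‖d * c‖ = ‖d * CFC.sqrt c * CFC.sqrt c‖ := by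
        rw [mul_assoc, CFC.sqrt_mul_sqrt_self c]
    _ ≤ ‖d * CFC.sqrt c‖ * ‖CFC.sqrt c‖ := norm_mul_le _ _
    _ ≤ _ := by rw [h2]; gcongr

theorem norm_conj_sub_le {g c : A} (hg : IsSelfAdjoint g) (hc : 0 ≤ c) {ε : ℝ}
    (h : ‖(1 - g) * c * (1 - g)‖ ≤ ε) : ‖g * c * g - c‖ ≤ 2 * (√ε * √‖c‖) + ε := by
  have hd : IsSelfAdjoint (1 - g) := (IsSelfAdjoint.one A).sub hg
  have h1 := norm_mul_le_of_conj_le hd hc h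
  have h2 : ‖c * (1 - g)‖ = ‖(1 - g) * c‖ := by
    rw [← norm_star, star_mul, hd.star_eq, (IsSelfAdjoint.of_nonneg hc).star_eq]
  have : g * c * g - c = (1 - g) * c * (1 - g) - (1 - g) * c - c * (1 - g) := by noncomm_ring
  rw [this]
  have h3 := norm_sub_le ((1 - g) * c * (1 - g) - (1 - g) * c) (c * (1 - g))
  have h4 := norm_sub_le ((1 - g) * c * (1 - g)) ((1 - g) * c)
  linarith

/-- The compression is by `g = f(b)` with `f(t) = √(t / (t + ε))`. -/
theorem exists_conj_add_algebraMap_le {b : A} (hb : 0 ≤ b) {ε : ℝ} (hε : 0 < ε) :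
    ∃ g : A, IsSelfAdjoint g ∧ g * (b + algebraMap ℝ A ε) * g ≤ b ∧
      ‖(1 - g) * (b + algebraMap ℝ A ε) * (1 - g)‖ ≤ ε := by
  have hsa : IsSelfAdjoint b := .of_nonneg hb
  have hsp : ∀ t ∈ spectrum ℝ b, 0 ≤ t := fun t ht => spectrum_nonneg_of_nonneg hb ht
  set f : ℝ → ℝ := fun t => √(t / (t + ε)) with hf
  have hfc : ContinuousOn f (spectrum ℝ b) := by
    refine ContinuousOn.sqrt (continuousOn_id.div (by fun_prop) fun t ht => ?_)
    have := hsp t ht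
    positivity
  have hb' : b + algebraMap ℝ A ε = cfc (fun t : ℝ => t + ε) b := by
    rw [cfc_add_const ε (fun t => t) b (by fun_prop), cfc_id' ℝ b]
  have h1 : 1 - cfc f b = cfc (fun t => 1 - f t) b := by
    rw [cfc_sub (fun _ => 1) f b (by fun_prop) hfc, cfc_const_one ℝ b]
  refine ⟨cfc f b, IsSelfAdjoint.cfc, le_of_eq ?_, ?_⟩
  · rw [hb', ← cfc_mul f _ b hfc (by fun_prop), ← cfc_mul (fun t => f t * (t + ε)) f b
      (hfc.mul (by fun_prop)) hfc]
    conv_rhs => rw [← cfc_id' ℝ b]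
    refine cfc_congr fun t ht => ?_
    have ht := hsp t ht
    have h2 : f t * f t = t / (t + ε) := Real.mul_self_sqrt (by positivity)
    calc f t * (t + ε) * f t = (f t * f t) * (t + ε) := by ring
      _ = t := by rw [h2]; field_simp
  · have h1c : ContinuousOn (fun t => 1 - f t) (spectrum ℝ b) := continuousOn_const.sub hfc
    rw [h1, hb', ← cfc_mul (fun t => 1 - f t) _ b h1c (by fun_prop),
      ← cfc_mul (fun t => (1 - f t) * (t + ε)) _ b (h1c.mul (by fun_prop)) h1c]
    refine norm_cfc_le hε.le fun t ht => ?_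
    have ht := hsp t ht
    have h2 : f t * f t = t / (t + ε) := Real.mul_self_sqrt (by positivity)
    have h3 : 0 ≤ f t := Real.sqrt_nonneg _
    have h4 : f t ≤ 1 := by
      rw [hf]; refine Real.sqrt_le_one.2 ?_
      rw [div_le_one (by positivity)]; linarith
    have h5 : f t * f t * (t + ε) = t := by rw [h2]; field_simp
    have h6 : 0 ≤ 1 - f t := by linarith
    rw [Real.norm_of_nonneg (by positivity)]
    -- `(1 - f)² ≤ 1 - f²` because `0 ≤ f ≤ 1`
    nlinarith [mul_nonneg (mul_nonneg h6 h3) (by positivity : 0 ≤ t + ε)]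

/-- An almost majorized element is compressed under the majorant at small cost in norm: if
`c ≤ b + ε` with `ε` small, then `g c g ≤ b` and `g c g` is close to `c`, with the same `g` for all
such `c`. This replaces the Riesz decomposition property, which fails in noncommutative
C*-algebras. -/
theorem exists_compression (R : ℝ) {η : ℝ} (hη : 0 < η) :
    ∃ ε : ℝ, 0 < ε ∧ ∀ b : A, 0 ≤ b → ∃ g : A, IsSelfAdjoint g ∧
      ∀ c : A, 0 ≤ c → c ≤ b + algebraMap ℝ A ε →
        g * c * g ≤ b ∧ (‖c‖ ≤ R → ‖g * c * g - c‖ < η) := by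
  have hlim : Tendsto (fun ε : ℝ => 2 * (√ε * √R) + ε) (𝓝[>] 0) (𝓝 0) := by
    have : Continuous (fun ε : ℝ => 2 * (√ε * √R) + ε) := by fun_prop
    simpa using (this.tendsto 0).mono_left nhdsWithin_le_nhds
  obtain ⟨ε, hε, hlt⟩ := (eventually_mem_nhdsWithin.and (hlim.eventually_lt_const hη)).exists
  refine ⟨ε, hε, fun b hb => ?_⟩
  obtain ⟨g, hg, h1, h2⟩ := exists_conj_add_algebraMap_le hb hε
  refine ⟨g, hg, fun c hc hcb => ⟨(hg.conjugate_le_conjugate hcb).trans h1, fun hR => ?_⟩⟩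
  have hd : IsSelfAdjoint (1 - g) := (IsSelfAdjoint.one A).sub hg
  have h3 : ‖(1 - g) * c * (1 - g)‖ ≤ ε :=
    (CStarAlgebra.norm_le_norm_of_nonneg_of_le (hd.conjugate_nonneg hc)
      (hd.conjugate_le_conjugate hcb)).trans h2
  refine (norm_conj_sub_le hg hc h3).trans_lt (lt_of_le_of_lt ?_ hlt)
  gcongr

/-- The element `k = (a + ε)^{-1/2}`. -/
theorem exists_inv_sqrt {a : A} (ha : 0 ≤ a) {ε : ℝ} (hε : 0 < ε) :
    ∃ k : A, IsSelfAdjoint k ∧ Commute k a ∧ k * (a + algebraMap ℝ A ε) * k = 1 := by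
  have hsa : IsSelfAdjoint a := .of_nonneg ha
  have hsp : ∀ t ∈ spectrum ℝ a, 0 ≤ t := fun t ht => spectrum_nonneg_of_nonneg ha ht
  set f : ℝ → ℝ := fun t => (√(t + ε))⁻¹ with hf
  have hfc : ContinuousOn f (spectrum ℝ a) := by
    refine ContinuousOn.inv₀ (by fun_prop) fun t ht => ?_
    have := hsp t ht
    positivity
  have ha' : a + algebraMap ℝ A ε = cfc (fun t : ℝ => t + ε) a := by
    rw [cfc_add_const ε (fun t => t) a (by fun_prop), cfc_id' ℝ a]
  refine ⟨cfc f a, IsSelfAdjoint.cfc, ?_, ?_⟩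
  · conv => arg 2; rw [← cfc_id' ℝ a]
    exact cfc_commute_cfc _ _ a
  · rw [ha', ← cfc_mul f _ a hfc (by fun_prop), ← cfc_mul (fun t => f t * (t + ε)) f a
      (hfc.mul (by fun_prop)) hfc, ← cfc_one ℝ a]
    refine cfc_congr fun t ht => ?_
    have ht := hsp t ht
    have h2 : √(t + ε) * √(t + ε) = t + ε := Real.mul_self_sqrt (by positivity)
    have h3 : 0 < √(t + ε) := by positivity
    simp only [hf, Pi.one_apply]
    field_simp
    rw [sq, h2]

/-- With `k = (a + ε)^{-1/2}` and `k (y y*) k ≤ 1`, the element `y* (k a k) y` differs from `y* y` by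
`ε y* k² y`, which has norm at most `ε`. -/
theorem norm_conj_inv_sqrt_sub_le {a k y : A} (hk : IsSelfAdjoint k) {ε : ℝ} (hε : 0 ≤ ε)
    (h1 : k * (a + algebraMap ℝ A ε) * k = 1) (h2 : k * (y * star y) * k ≤ 1) :
    ‖star y * (k * a * k) * y - star y * y‖ ≤ ε := by
  have h3 : k * a * k = 1 - ε • (k * k) := by
    rw [← h1, Algebra.algebraMap_eq_smul_one]
    simp [mul_add, add_mul]
  have h4 : star y * (k * a * k) * y - star y * y = -(ε • (star (k * y) * (k * y))) := by
    rw [h3, star_mul, hk.star_eq]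
    simp only [mul_sub, sub_mul, mul_one, mul_smul_comm, smul_mul_assoc, mul_assoc]
    abel
  have h5 : ‖star (k * y) * (k * y)‖ ≤ 1 := by
    rw [CStarRing.norm_star_mul_self, ← CStarRing.norm_self_mul_star, star_mul, hk.star_eq]
    have : k * y * (star y * k) = k * (y * star y) * k := by simp only [mul_assoc]
    rw [this]
    exact (CStarAlgebra.norm_le_one_iff_of_nonneg _
      (hk.conjugate_nonneg (mul_star_self_nonneg y))).2 h2
  rw [h4, norm_neg, norm_smul, Real.norm_of_nonneg hε]
  nlinarith

end Compression

/-! ### The semicontinuous regularization of a weight -/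

section Regularization

open scoped Pointwise

set_option linter.unusedSectionVars false

variable {A : Type*} [CStarAlgebra A] [PartialOrder A] [StarOrderedRing A]

theorem IsWeight.mono {τ : PosCone A → ℝ≥0∞} (hτ : IsWeight τ) {a b : PosCone A} (h : a ≤ b) :
    τ a ≤ τ b := by
  have : b = a + ⟨b.1 - a.1, sub_nonneg.2 h⟩ := Subtype.ext (add_sub_cancel a.1 b.1).symm
  rw [this, hτ.map_add]
  exact le_self_add

theorem IsWeight.map_zero {τ : PosCone A → ℝ≥0∞} (hτ : IsWeight τ) : τ 0 = 0 := by
  have h := hτ.map_smul 0 0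
  rwa [show posSMul 0 (0 : PosCone A) = 0 from Subtype.ext (smul_zero _), ENNReal.coe_zero,
    zero_mul] at h

theorem adConj_mono (u : A) {a b : PosCone A} (h : a ≤ b) : adConj u a ≤ adConj u b :=
  star_right_conjugate_le_conjugate (show a.1 ≤ b.1 from h) u

theorem adConj_adConj (u v : A) (a : PosCone A) : adConj u (adConj v a) = adConj (u * v) a :=
  Subtype.ext <| by simp only [adConj, star_mul, mul_assoc]

theorem adConj_one (a : PosCone A) : adConj 1 a = a :=
  Subtype.ext <| by simp [adConj]

theorem continuous_adConj : Continuous fun p : A × PosCone A => adConj p.1 p.2 :=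
  Continuous.subtype_mk (by fun_prop) _

theorem semicontReg_le (τ₀ : PosCone A → ℝ≥0∞) (a : PosCone A) : semicontReg τ₀ a ≤ τ₀ a :=
  iSup₂_le fun _ h => h a

theorem continuous_positiveLinearMap (ψ : A →ₚ[ℂ] ℂ) : Continuous ψ := by
  obtain ⟨C, hC⟩ := ψ.exists_norm_apply_le
  exact AddMonoidHomClass.continuous_of_bound ψ C hC

theorem lowerSemicontinuous_semicontReg (τ₀ : PosCone A → ℝ≥0∞) :
    LowerSemicontinuous (semicontReg τ₀) := by
  refine lowerSemicontinuous_iSup fun ψ => lowerSemicontinuous_iSup fun _ =>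
    Continuous.lowerSemicontinuous ?_
  exact ENNReal.continuous_ofReal.comp (Complex.continuous_re.comp
    ((continuous_positiveLinearMap ψ).comp continuous_subtype_val))

/-- The convex set to which the Hahn–Banach theorem is applied: the elements whose real part is
majorized by some `b ≥ 0` with `τ₀ b ≤ t`. -/
def majorized (τ₀ : PosCone A → ℝ≥0∞) (t : ℝ≥0) : Set A :=
  {x | ∃ b : PosCone A, τ₀ b ≤ t ∧ x + star x ≤ b.1 + b.1}

theorem convex_majorized {τ₀ : PosCone A → ℝ≥0∞} (hτ : IsWeight τ₀) (t : ℝ≥0) :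
    Convex ℝ (majorized τ₀ t) := by
  rintro x ⟨b, hb, hxb⟩ y ⟨c, hc, hyc⟩ p q hp hq hpq
  lift p to ℝ≥0 using hp
  lift q to ℝ≥0 using hq
  refine ⟨posSMul p b + posSMul q c, ?_, ?_⟩
  · rw [hτ.map_add, hτ.map_smul, hτ.map_smul]
    calc (p : ℝ≥0∞) * τ₀ b + q * τ₀ c ≤ p * t + q * t := by gcongr
      _ = t := by
        rw [← add_mul, ← ENNReal.coe_add, show p + q = 1 from by exact_mod_cast hpq]; simp
  · have h1 : (p : ℝ) • (x + star x) ≤ (p : ℝ) • (b.1 + b.1) := smul_le_smul_of_nonneg_left hxb p.2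
    have h2 : (q : ℝ) • (y + star y) ≤ (q : ℝ) • (c.1 + c.1) := smul_le_smul_of_nonneg_left hyc q.2
    have h3 := add_le_add h1 h2
    change _ ≤ ((p : ℝ) • b.1 + (q : ℝ) • c.1) + ((p : ℝ) • b.1 + (q : ℝ) • c.1)
    convert h3 using 1
    · simp only [star_add, star_smul, star_trivial, smul_add]; abel
    · simp only [smul_add]; abel

theorem nonpos_of_forall_mul_lt {s C : ℝ} (h : ∀ r : ℝ, 0 ≤ r → r * s < C) : s ≤ 0 := by
  by_contra! hs
  have hC : 0 < C := by simpa using h 0 le_rfl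
  have := h (C / s) (by positivity)
  rw [div_mul_cancel₀ _ hs.ne'] at this
  exact this.false

/-- The Hahn–Banach step: if `τ₀ > t` on all `b ≥ 0` with `a ≤ b + ε`, then some positive functional
dominated by `τ₀` takes the value `t` at `a`. -/
theorem le_semicontReg_of_forall {τ₀ : PosCone A → ℝ≥0∞} (hτ : IsWeight τ₀) (a : PosCone A)
    {ε : ℝ} (hε : 0 < ε) (t : ℝ≥0)
    (h : ∀ b : PosCone A, a.1 ≤ b.1 + algebraMap ℝ A ε → t < τ₀ b) :
    t ≤ semicontReg τ₀ a := by
  rcases eq_or_ne t 0 with rfl | ht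
  · simp
  have ht : 0 < t := pos_iff_ne_zero.2 ht
  have hball : (0 : A) ∈ Metric.ball (0 : A) ε := Metric.mem_ball_self hε
  have hnot : a.1 ∉ majorized τ₀ t + Metric.ball (0 : A) ε := by
    rintro ⟨x, ⟨b, hb, hxb⟩, y, hy, hxy⟩
    refine (h b ?_).not_ge hb
    have hy' : ‖y + star y‖ ≤ ε + ε := by
      refine (norm_add_le _ _).trans ?_
      rw [norm_star]
      have := mem_ball_zero_iff.1 hy
      linarith
    have h1 : y + star y ≤ algebraMap ℝ A (ε + ε) :=
      (IsSelfAdjoint.add_star_self y).le_algebraMap_norm_self.trans (algebraMap_mono A hy')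
    have h2 : a.1 + a.1 ≤ (b.1 + algebraMap ℝ A ε) + (b.1 + algebraMap ℝ A ε) := by
      have h3 : a.1 + a.1 = (x + star x) + (y + star y) := by
        nth_rewrite 2 [← (IsSelfAdjoint.of_nonneg a.2).star_eq]
        rw [← hxy]
        change x + y + star (x + y) = _
        rw [star_add]
        abel
      rw [h3]
      refine (add_le_add hxb h1).trans (le_of_eq ?_)
      rw [map_add]; abel
    have h4 := smul_le_smul_of_nonneg_left h2 (by norm_num : (0 : ℝ) ≤ 1 / 2)
    simpa [← two_smul ℝ, smul_smul] using h4
  obtain ⟨f, hf⟩ := geometric_hahn_banach_open_point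
    ((convex_majorized hτ t).add (convex_ball (0 : A) ε))
    (Metric.isOpen_ball.add_left) hnot
  have hf' : ∀ x ∈ majorized τ₀ t, f x < f a.1 := fun x hx => by
    simpa using hf (x + 0) (add_mem_add hx hball)
  have ha : 0 < f a.1 := by
    simpa using hf' 0 ⟨0, by rw [hτ.map_zero]; exact zero_le, by simp⟩
  -- on the positive cone, `f` is bounded by `f a` times the weight
  have hle : ∀ b : PosCone A, τ₀ b ≤ t → f b.1 ≤ f a.1 := fun b hb =>
    (hf' b.1 ⟨b, hb, by rw [(IsSelfAdjoint.of_nonneg b.2).star_eq]⟩).le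
  have hpos : ∀ x : A, 0 ≤ x → 0 ≤ f x := fun x hx => by
    have : -f x ≤ 0 := nonpos_of_forall_mul_lt (C := f a.1) fun r hr => by
      have := hf' (-(r • x)) ⟨0, by rw [hτ.map_zero]; exact zero_le, by
        have : 0 ≤ r • x := smul_nonneg hr hx
        rw [star_neg, (IsSelfAdjoint.of_nonneg this).star_eq]
        change _ ≤ (0 : A) + 0
        rw [← neg_add, add_zero, neg_nonpos]
        exact add_nonneg this this⟩
      simpa using this
    linarith
  -- the majorized set contains the skew-adjoint elements, so `f` vanishes on them and its
  -- complexification agrees with `f` on the positive cone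
  have hskew : ∀ x : A, IsSelfAdjoint x → f (Complex.I • x) = 0 := fun x hx => by
    have key : ∀ s : ℝ, s * f (Complex.I • x) ≤ 0 := fun s =>
      nonpos_of_forall_mul_lt (C := f a.1) fun r _ => by
        have := hf' ((r * s) • Complex.I • x) ⟨0, by rw [hτ.map_zero]; exact zero_le, by
          rw [star_smul, star_smul, hx.star_eq]
          simp⟩
        simpa [mul_assoc] using this
    have h1 := key 1
    have h2 := key (-1)
    linarith
  set c : ℝ := t / f a.1 with hc
  have hc0 : 0 < c := by positivity
  have hval : ∀ x : A, 0 ≤ x → (StrongDual.extendRCLike (𝕜 := ℂ) (c • f)) x = (c * f x : ℝ) :=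
    fun x hx => by
      rw [StrongDual.extendRCLike_apply]
      simp [hskew x (.of_nonneg hx)]
  let ψ : A →ₚ[ℂ] ℂ := PositiveLinearMap.mk₀
    (StrongDual.extendRCLike (𝕜 := ℂ) (c • f)).toLinearMap fun x hx => by
      change 0 ≤ (StrongDual.extendRCLike (𝕜 := ℂ) (c • f)) x
      rw [hval x hx]
      exact_mod_cast mul_nonneg hc0.le (hpos x hx)
  have hψ : ∀ b : PosCone A, (ψ b.1).re = c * f b.1 := fun b => by
    change ((StrongDual.extendRCLike (𝕜 := ℂ) (c • f)) b.1).re = _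
    rw [hval b.1 b.2, Complex.ofReal_re]
  refine le_iSup₂_of_le ψ (fun b => ?_) ?_
  · rw [hψ]
    rcases eq_or_ne (τ₀ b) ∞ with hb | hb
    · rw [hb]; exact le_top
    lift τ₀ b to ℝ≥0 using hb with s hs
    rw [ENNReal.ofReal_le_iff_le_toReal ENNReal.coe_ne_top, ENNReal.coe_toReal]
    have hmul : ∀ r : ℝ≥0, r * s ≤ t → r * f b.1 ≤ f a.1 := fun r hr => by
      simpa [posSMul] using hle (posSMul r b) (by rw [hτ.map_smul, ← hs]; exact_mod_cast hr)
    rcases eq_or_ne s 0 with rfl | hs0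
    · have : f b.1 ≤ 0 := nonpos_of_forall_mul_lt (C := f a.1 + 1) fun r hr => by
        lift r to ℝ≥0 using hr
        have := hmul r (by simp)
        linarith
      simpa using mul_nonpos_of_nonneg_of_nonpos hc0.le this
    · have hs0 : 0 < s := pos_iff_ne_zero.2 hs0
      have h1 := hmul (t / s) (by rw [div_mul_cancel₀ _ hs0.ne'])
      rw [NNReal.coe_div, div_mul_eq_mul_div, div_le_iff₀ (by exact_mod_cast hs0)] at h1
      rw [hc, div_mul_eq_mul_div, div_le_iff₀ ha]
      linarith
  · rw [hψ, hc, div_mul_cancel₀ _ ha.ne', ENNReal.ofReal_coe_nnreal]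

/-- The semicontinuous regularization is approximated by the values of the weight at nearby points:
it is the largest lower semicontinuous minorant. -/
theorem exists_near_of_semicontReg_lt {τ₀ : PosCone A → ℝ≥0∞} (hτ : IsWeight τ₀) {a : PosCone A}
    {t : ℝ≥0∞} (h : semicontReg τ₀ a < t) {U : Set (PosCone A)} (hU : U ∈ 𝓝 a) :
    ∃ b ∈ U, τ₀ b < t := by
  obtain ⟨s, hs, hst⟩ := ENNReal.lt_iff_exists_nnreal_btwn.1 h
  obtain ⟨η, hη, hηU⟩ := Metric.mem_nhds_iff.1 hU
  obtain ⟨ε, hε, H⟩ := exists_compression (A := A) ‖a.1‖ hη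
  obtain ⟨b, hb, hbs⟩ : ∃ b : PosCone A, a.1 ≤ b.1 + algebraMap ℝ A ε ∧ τ₀ b ≤ s := by
    by_contra! hcon
    exact hs.not_ge (le_semicontReg_of_forall hτ a hε s hcon)
  obtain ⟨g, hg, hgc⟩ := H b.1 b.2
  obtain ⟨h1, h2⟩ := hgc a.1 a.2 hb
  refine ⟨⟨g * a.1 * g, hg.conjugate_nonneg a.2⟩, hηU ?_, (hτ.mono h1).trans_lt (hbs.trans_lt hst)⟩
  rw [Metric.mem_ball, Subtype.dist_eq, dist_eq_norm]
  exact h2 le_rfl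

/-- Upper estimates for a weight along a continuous map of the cone pass to its semicontinuous
regularization. With the identity map, this says that lower semicontinuous minorants stay below the
regularization. -/
theorem le_semicontReg_of_comp_le {τ₀ : PosCone A → ℝ≥0∞} (hτ : IsWeight τ₀)
    {σ : PosCone A → ℝ≥0∞} (hσ : LowerSemicontinuous σ) {F : PosCone A → PosCone A}
    (hF : Continuous F) {c : ℝ≥0} (h : ∀ b, τ₀ b < ∞ → σ (F b) ≤ c * τ₀ b) (hc : c ≠ 0)
    (a : PosCone A) : σ (F a) ≤ c * semicontReg τ₀ a := by
  by_contra! hlt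
  have h1 : semicontReg τ₀ a < (c : ℝ≥0∞)⁻¹ * σ (F a) := by
    rwa [mul_comm, ← div_eq_mul_inv, ENNReal.lt_div_iff_mul_lt (.inl (by simpa)) (.inl (by simp)),
      mul_comm]
  obtain ⟨t, ht, ht'⟩ := exists_between h1
  have h2 : c * t < σ (F a) := by
    rwa [mul_comm, ← div_eq_mul_inv, ENNReal.lt_div_iff_mul_lt (.inl (by simpa)) (.inl (by simp)),
      mul_comm] at ht'
  have hU : {b | c * t < σ (F b)} ∈ 𝓝 a := (hF.tendsto a).eventually (hσ (F a) _ h2)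
  obtain ⟨b, hb, hbt⟩ := exists_near_of_semicontReg_lt hτ ht hU
  have := (h b (hbt.trans_le le_top)).trans (mul_le_mul_right hbt.le _)
  exact (lt_of_lt_of_le hb this).false

theorem le_semicontReg {τ₀ : PosCone A → ℝ≥0∞} (hτ : IsWeight τ₀)
    {σ : PosCone A → ℝ≥0∞} (hσ : LowerSemicontinuous σ) (h : ∀ b, σ b ≤ τ₀ b) (a : PosCone A) :
    σ a ≤ semicontReg τ₀ a := by
  simpa using le_semicontReg_of_comp_le hτ hσ continuous_id (c := 1) (fun b _ => by simpa using h b)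
    one_ne_zero a

theorem semicontReg_eq_self_iff {τ₀ : PosCone A → ℝ≥0∞} (hτ : IsWeight τ₀) :
    semicontReg τ₀ = τ₀ ↔ LowerSemicontinuous τ₀ := by
  refine ⟨fun h => h ▸ lowerSemicontinuous_semicontReg τ₀, fun h => funext fun a => ?_⟩
  exact le_antisymm (semicontReg_le _ _) (le_semicontReg hτ h (fun _ => le_rfl) a)

theorem semicontReg_add_le (τ₀ : PosCone A → ℝ≥0∞) (a b : PosCone A) :
    semicontReg τ₀ (a + b) ≤ semicontReg τ₀ a + semicontReg τ₀ b := by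
  refine iSup₂_le fun ψ hψ => ?_
  have : (ψ (a + b).1).re = (ψ a.1).re + (ψ b.1).re := by
    change (ψ (a.1 + b.1)).re = _
    rw [map_add, Complex.add_re]
  rw [this]
  refine ENNReal.ofReal_add_le.trans (add_le_add ?_ ?_)
  · exact le_iSup₂_of_le ψ hψ le_rfl
  · exact le_iSup₂_of_le ψ hψ le_rfl

theorem le_semicontReg_add {τ₀ : PosCone A → ℝ≥0∞} (hτ : IsWeight τ₀) (a₁ a₂ : PosCone A) :
    semicontReg τ₀ a₁ + semicontReg τ₀ a₂ ≤ semicontReg τ₀ (a₁ + a₂) := by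
  set σ := semicontReg τ₀ with hσ
  have hlsc := lowerSemicontinuous_semicontReg τ₀
  by_contra! hlt
  obtain ⟨s, hs, hs'⟩ := exists_between hlt
  have hadd : LowerSemicontinuous fun p : PosCone A × PosCone A => σ p.1 + σ p.2 :=
    (LowerSemicontinuous.comp (f := σ) hlsc continuous_fst).add (LowerSemicontinuous.comp (f := σ) hlsc continuous_snd)
  obtain ⟨η, hη, Hη⟩ := Metric.eventually_nhds_iff.1 (hadd (a₁, a₂) s hs')
  obtain ⟨ε, hε, H⟩ := exists_compression (A := A) (max ‖a₁.1‖ ‖a₂.1‖) hη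
  obtain ⟨b, hb, hbs⟩ := exists_near_of_semicontReg_lt hτ hs (Metric.ball_mem_nhds _ hε)
  have hle : (a₁ + a₂).1 ≤ b.1 + algebraMap ℝ A ε := by
    rw [Metric.mem_ball', Subtype.dist_eq, dist_eq_norm] at hb
    rw [← sub_le_iff_le_add']
    exact ((IsSelfAdjoint.of_nonneg (a₁ + a₂).2).sub
      (.of_nonneg b.2)).le_algebraMap_norm_self.trans (algebraMap_mono A hb.le)
  have hle₁ : a₁.1 ≤ b.1 + algebraMap ℝ A ε := (le_add_of_nonneg_right a₂.2).trans hle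
  have hle₂ : a₂.1 ≤ b.1 + algebraMap ℝ A ε := (le_add_of_nonneg_left a₁.2).trans hle
  obtain ⟨g, hg, hgc⟩ := H b.1 b.2
  have h12 := (hgc _ (a₁ + a₂).2 hle).1
  have h1 := (hgc _ a₁.2 hle₁).2 (le_max_left _ _)
  have h2 := (hgc _ a₂.2 hle₂).2 (le_max_right _ _)
  set b₁ : PosCone A := ⟨g * a₁.1 * g, hg.conjugate_nonneg a₁.2⟩
  set b₂ : PosCone A := ⟨g * a₂.1 * g, hg.conjugate_nonneg a₂.2⟩
  have hs₁₂ : s < σ b₁ + σ b₂ := Hη (y := (b₁, b₂)) (by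
    rw [Prod.dist_eq, Subtype.dist_eq, Subtype.dist_eq, dist_eq_norm, dist_eq_norm]
    exact max_lt h1 h2)
  have hbb : b₁ + b₂ ≤ b := by
    change g * a₁.1 * g + g * a₂.1 * g ≤ b.1
    rwa [← add_mul, ← mul_add]
  refine (hs₁₂.trans_le ?_).not_ge hbs.le
  calc σ b₁ + σ b₂ ≤ τ₀ b₁ + τ₀ b₂ := add_le_add (semicontReg_le _ _) (semicontReg_le _ _)
    _ = τ₀ (b₁ + b₂) := (hτ.map_add _ _).symm
    _ ≤ τ₀ b := hτ.mono hbb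

theorem isWeight_semicontReg {τ₀ : PosCone A → ℝ≥0∞} (hτ : IsWeight τ₀) :
    IsWeight (semicontReg τ₀) where
  map_add a b := le_antisymm (semicontReg_add_le τ₀ a b) (le_semicontReg_add hτ a b)
  map_smul r a := by
    simp only [semicontReg, ENNReal.mul_iSup]
    refine iSup_congr fun ψ => iSup_congr fun _ => ?_
    have : (ψ (posSMul r a).1).re = r * (ψ a.1).re := by
      change (ψ ((r : ℝ) • a.1)).re = _
      rw [← Complex.coe_smul, map_smul, smul_eq_mul, Complex.re_ofReal_mul]
    rw [this, ENNReal.ofReal_mul (p := (r : ℝ)) r.2, ENNReal.ofReal_coe_nnreal]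

end Regularization

/-! ### Unitary invariance and the trace property -/

section Invariance

set_option linter.unusedSectionVars false

variable {A : Type*} [CStarAlgebra A] [PartialOrder A] [StarOrderedRing A]

/-- `τ` is invariant under the unitaries of `A`. The inequality suffices: applied to `u*`, it gives
the converse one. -/
def IsUnitarilyInvariant (τ : PosCone A → ℝ≥0∞) : Prop :=
  ∀ u ∈ unitary A, ∀ a : PosCone A, τ (adConj u a) ≤ τ a

theorem isUnit_of_isDeltaUnitary_one {u : A} (hu : IsDeltaUnitary 1 u) : IsUnit u := by
  have h1 : IsUnit (star u * u) := by
    have := isUnit_one_sub_of_norm_lt_one (x := 1 - star u * u) (by rw [norm_sub_rev]; exact hu.1)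
    simpa using this
  have h2 : IsUnit (u * star u) := by
    have := isUnit_one_sub_of_norm_lt_one (x := 1 - u * star u) (by rw [norm_sub_rev]; exact hu.2)
    simpa using this
  obtain ⟨v, hv⟩ := h1.exists_left_inv
  obtain ⟨w, hw⟩ := h2.exists_right_inv
  exact isUnit_iff_exists_and_exists.2
    ⟨⟨star u * w, by rw [← mul_assoc, hw]⟩, ⟨v * star u, by rw [mul_assoc, hv]⟩⟩

theorem IsDeltaUnitary.mono {δ δ' : ℝ} (h : δ ≤ δ') {u : A} (hu : IsDeltaUnitary δ u) :
    IsDeltaUnitary δ' u :=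
  ⟨hu.1.trans_le h, hu.2.trans_le h⟩

theorem isEpsInvariant_semicontReg {τ₀ : PosCone A → ℝ≥0∞} (hτ : IsWeight τ₀)
    {A₀ : NonUnitalStarSubalgebra ℂ A} (h : IsEpsInvariant A₀ τ₀) :
    IsEpsInvariant A₀ (semicontReg τ₀) := by
  intro ε hε hε1
  obtain ⟨δ, hδ, H⟩ := h ε hε hε1
  refine ⟨min δ 1, lt_min hδ one_pos, fun u hu hδu a => ?_⟩
  have hlsc := lowerSemicontinuous_semicontReg τ₀
  have hcont : ∀ v : A, Continuous (adConj v) := fun v =>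
    continuous_adConj.comp (Continuous.prodMk_right v)
  constructor
  · obtain ⟨v, rfl⟩ := isUnit_of_isDeltaUnitary_one (hδu.mono (min_le_right _ _))
    -- Compare along the conjugation by the inverse of `u`, which need not lie in `A₀`.
    set c : ℝ≥0 := (1 - ε).toNNReal with hc
    have hc0 : c ≠ 0 := by simpa [hc] using hε1
    have key := le_semicontReg_of_comp_le hτ hlsc (hcont (v⁻¹ : Aˣ)) (c := c⁻¹)
      (fun b _ => ?_) (inv_ne_zero hc0) (adConj (v : A) a)
    · rw [adConj_adConj, Units.inv_mul, adConj_one, ENNReal.coe_inv hc0, mul_comm,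
        ← div_eq_mul_inv, ENNReal.le_div_iff_mul_le (.inl (by simpa)) (.inl (by simp)),
        mul_comm] at key
      exact key
    · have h1 := (H v hu (hδu.mono (min_le_left _ _)) (adConj (v⁻¹ : Aˣ) b)).1
      rw [adConj_adConj, Units.mul_inv, adConj_one] at h1
      rw [ENNReal.coe_inv hc0, mul_comm,
        ← div_eq_mul_inv, ENNReal.le_div_iff_mul_le (.inl (by simpa)) (.inl (by simp)), mul_comm]
      exact (mul_le_mul_right (semicontReg_le _ _) _).trans h1
  · refine le_semicontReg_of_comp_le hτ hlsc (hcont u) (c := (1 + ε).toNNReal)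
      (fun b _ => (semicontReg_le _ _).trans (H u hu (hδu.mono (min_le_left _ _)) b).2) ?_ a
    have : 0 < 1 + ε := by linarith
    simpa using this

/-- Unitaries are norm limits of elements of a dense subset, so a lower semicontinuous functional
that almost decreases under conjugation by the elements of the subset close to a unitary is
unitarily invariant. -/
theorem isUnitarilyInvariant_of_dense {τ : PosCone A → ℝ≥0∞} (hlsc : LowerSemicontinuous τ)
    {S : Set A} (hS : Dense S)
    (h : ∀ u ∈ unitary A, ∀ ε : ℝ, 0 < ε → ∀ᶠ v in 𝓝 u, v ∈ S → ∀ a : PosCone A,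
      τ (adConj v a) ≤ ENNReal.ofReal (1 + ε) * τ a) : IsUnitarilyInvariant τ := by
  intro u hu a
  have key : ∀ ε : ℝ, 0 < ε → τ (adConj u a) ≤ ENNReal.ofReal (1 + ε) * τ a := fun ε hε => by
    refine le_of_forall_lt fun t ht => ?_
    have h1 : ∀ᶠ v in 𝓝 u, t < τ (adConj v a) :=
      ((continuous_adConj.comp (Continuous.prodMk_left a)).tendsto u).eventually
        (hlsc (adConj u a) t ht)
    obtain ⟨v, hvS, hv1, hv2⟩ := ((mem_closure_iff_frequently.1 (hS u)).and_eventually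
      (h1.and (h u hu ε hε))).exists
    exact hv1.trans_le (hv2 hvS a)
  rcases eq_or_ne (τ a) ∞ with hτ | hτ
  · rw [hτ]; exact le_top
  have hlim : Tendsto (fun ε : ℝ => ENNReal.ofReal (1 + ε) * τ a) (𝓝[>] 0) (𝓝 (1 * τ a)) := by
    refine ENNReal.Tendsto.mul_const ?_ (.inl one_ne_zero)
    have : Continuous fun ε : ℝ => ENNReal.ofReal (1 + ε) :=
      ENNReal.continuous_ofReal.comp (by fun_prop)
    simpa using (this.tendsto 0).mono_left nhdsWithin_le_nhds
  rw [one_mul] at hlim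
  exact ge_of_tendsto hlim (eventually_mem_nhdsWithin.mono fun ε hε => key ε hε)

theorem eventually_isDeltaUnitary {u : A} (hu : u ∈ unitary A) {δ : ℝ} (hδ : 0 < δ) :
    ∀ᶠ v in 𝓝 u, IsDeltaUnitary δ v := by
  have h1 : Continuous fun v : A => ‖star v * v - 1‖ := by fun_prop
  have h2 : Continuous fun v : A => ‖v * star v - 1‖ := by fun_prop
  refine ((h1.tendsto u).eventually_lt_const ?_).and ((h2.tendsto u).eventually_lt_const ?_)
  · simpa [Unitary.star_mul_self_of_mem hu] using hδ
  · simpa [Unitary.mul_star_self_of_mem hu] using hδ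

theorem IsEpsInvariant.isUnitarilyInvariant {τ : PosCone A → ℝ≥0∞} (hlsc : LowerSemicontinuous τ)
    {A₀ : NonUnitalStarSubalgebra ℂ A} (hA₀ : Dense (A₀ : Set A)) (h : IsEpsInvariant A₀ τ) :
    IsUnitarilyInvariant τ := by
  refine isUnitarilyInvariant_of_dense hlsc hA₀ fun u hu ε hε => ?_
  obtain ⟨δ, hδ, H⟩ := h (min ε (1 / 2)) (by positivity)
    ((min_le_right _ _).trans_lt (by norm_num))
  filter_upwards [eventually_isDeltaUnitary hu hδ] with v hv hvS a
  refine (H v hvS hv a).2.trans ?_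
  gcongr
  exact min_le_left _ _

end Invariance

/-! ### The linear extension of a unitarily invariant weight -/

section Tracial

set_option linter.unusedSectionVars false

variable {A : Type*} [CStarAlgebra A] [PartialOrder A] [StarOrderedRing A]
  {τ : PosCone A → ℝ≥0∞}

/-- `x ∈ A` satisfies `τ(x* x) < ∞`. -/
def IsSquareFinite (τ : PosCone A → ℝ≥0∞) (x : A) : Prop :=
  τ ⟨star x * x, star_mul_self_nonneg x⟩ < ∞

theorem IsWeight.lt_top_of_le (hτ : IsWeight τ) {a : PosCone A} (ha : τ a < ∞) {x : A}
    (hx : 0 ≤ x) (h : x ≤ a.1) : τ ⟨x, hx⟩ < ∞ :=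
  (hτ.mono (a := ⟨x, hx⟩) h).trans_lt ha

theorem IsWeight.add_lt_top (hτ : IsWeight τ) {a b : PosCone A} (ha : τ a < ∞) (hb : τ b < ∞) :
    τ (a + b) < ∞ := by
  rw [hτ.map_add]; exact ENNReal.add_lt_top.2 ⟨ha, hb⟩

theorem IsWeight.smul_lt_top (hτ : IsWeight τ) (r : ℝ≥0) {a : PosCone A} (ha : τ a < ∞) :
    τ (posSMul r a) < ∞ := by
  rw [hτ.map_smul]; exact ENNReal.mul_lt_top ENNReal.coe_lt_top ha

theorem IsSquareFinite.add (hτ : IsWeight τ) {x y : A} (hx : IsSquareFinite τ x)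
    (hy : IsSquareFinite τ y) : IsSquareFinite τ (x + y) := by
  have h := hτ.add_lt_top hx hy
  refine hτ.lt_top_of_le (hτ.add_lt_top h h) _ ?_
  -- `|x + y|² ≤ |x + y|² + |x - y|² = 2 (|x|² + |y|²)`
  have h1 := star_mul_self_nonneg (x - y)
  change _ ≤ (star x * x + star y * y) + (star x * x + star y * y)
  rw [← sub_nonneg]
  convert h1 using 1
  simp only [star_add, star_sub]
  noncomm_ring

theorem IsSquareFinite.mul_left (hτ : IsWeight τ) {x : A} (hx : IsSquareFinite τ x) (b : A) :
    IsSquareFinite τ (b * x) := by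
  refine hτ.lt_top_of_le (hτ.smul_lt_top (‖b‖₊ ^ 2) hx) _ ?_
  change _ ≤ ((‖b‖₊ ^ 2 : ℝ≥0) : ℝ) • (star x * x)
  have h := star_left_conjugate_le_conjugate
    (CStarAlgebra.star_mul_le_algebraMap_norm_sq (a := b)) x
  rw [star_mul]
  calc star x * star b * (b * x) = star x * (star b * b) * x := by simp only [mul_assoc]
    _ ≤ _ := h
    _ = _ := by
      rw [Algebra.algebraMap_eq_smul_one, mul_smul_comm, smul_mul_assoc, mul_one]; simp

theorem IsSquareFinite.smul (hτ : IsWeight τ) {x : A} (hx : IsSquareFinite τ x) (c : ℂ) :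
    IsSquareFinite τ (c • x) := by
  simpa using hx.mul_left hτ (c • 1)

theorem isSquareFinite_zero (hτ : IsWeight τ) : IsSquareFinite τ 0 := by
  have : τ ⟨star (0 : A) * 0, star_mul_self_nonneg 0⟩ = τ 0 := by
    congr 1; exact Subtype.ext (mul_zero _)
  rw [IsSquareFinite, this, hτ.map_zero]
  exact ENNReal.zero_lt_top

theorem IsSquareFinite.mul_right (hτ : IsWeight τ) (hu : IsUnitarilyInvariant τ) {x : A}
    (hx : IsSquareFinite τ x) (b : A) : IsSquareFinite τ (x * b) := by
  have hb : b ∈ Submodule.span ℂ (unitary A : Set A) := by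
    rw [CStarAlgebra.span_unitary]; trivial
  induction hb using Submodule.span_induction with
  | mem u hu' =>
    refine lt_of_le_of_lt (le_of_eq_of_le ?_ (hu (star u) (Unitary.star_mem hu') _)) hx
    congr 1
    exact Subtype.ext (by simp only [adConj, star_mul, star_star, mul_assoc])
  | zero => rw [mul_zero]; exact isSquareFinite_zero hτ
  | add b c _ _ hb hc => rw [mul_add]; exact hb.add hτ hc
  | smul c b _ hb => rw [mul_smul_comm]; exact hb.smul hτ c

theorem mem_domainSpan {a : A} (ha : 0 ≤ a) (h : τ ⟨a, ha⟩ < ∞) : a ∈ domainSpan τ :=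
  Submodule.subset_span ⟨ha, h⟩

theorem IsSquareFinite.star_mul_mem (hτ : IsWeight τ) {x y : A} (hx : IsSquareFinite τ x)
    (hy : IsSquareFinite τ y) : star x * y ∈ domainSpan τ := by
  have key : ∀ c : ℂ, star (y + c • x) * (y + c • x) ∈ domainSpan τ := fun c =>
    mem_domainSpan _ (hy.add hτ (hx.smul hτ c))
  have hpol : star x * y = (1 / 4 : ℂ) • (star (y + (1 : ℂ) • x) * (y + (1 : ℂ) • x)
      - star (y + (-1 : ℂ) • x) * (y + (-1 : ℂ) • x)
      + Complex.I • (star (y + Complex.I • x) * (y + Complex.I • x))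
      - Complex.I • (star (y + (-Complex.I) • x) * (y + (-Complex.I) • x))) := by
    simp only [star_add, star_smul, mul_add, add_mul, smul_mul_assoc, mul_smul_comm, smul_smul,
      smul_add, smul_sub]
    simp only [RCLike.star_def, map_neg, map_one, Complex.conj_I]
    match_scalars <;> simp
    ring
  rw [hpol]
  refine Submodule.smul_mem _ _ (Submodule.sub_mem _ (Submodule.add_mem _ (Submodule.sub_mem _
    (key _) (key _)) (Submodule.smul_mem _ _ (key _))) (Submodule.smul_mem _ _ (key _)))

theorem sqrt_mul_sqrt_eq_star_mul {a : A} (ha : 0 ≤ a) :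
    star (CFC.sqrt a) * CFC.sqrt a = a := by
  rw [(IsSelfAdjoint.of_nonneg (CFC.sqrt_nonneg a)).star_eq, CFC.sqrt_mul_sqrt_self a]

theorem isSquareFinite_sqrt {a : A} (ha : 0 ≤ a) (h : τ ⟨a, ha⟩ < ∞) :
    IsSquareFinite τ (CFC.sqrt a) := by
  simpa only [IsSquareFinite, sqrt_mul_sqrt_eq_star_mul ha] using h

/-- The elements `x` with `τ(x* x) < ∞` form a two-sided ideal, and the span of the domain of `τ` is
spanned by the products `x* y` of such elements. -/
theorem domainSpan_mul_mem_right (hτ : IsWeight τ) (hu : IsUnitarilyInvariant τ) {a : A}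
    (ha : a ∈ domainSpan τ) (b : A) : a * b ∈ domainSpan τ := by
  induction ha using Submodule.span_induction with
  | mem a h =>
    obtain ⟨h0, h⟩ := h
    have hs := isSquareFinite_sqrt h0 h
    rw [← sqrt_mul_sqrt_eq_star_mul h0, mul_assoc]
    exact hs.star_mul_mem hτ (hs.mul_right hτ hu b)
  | zero => rw [zero_mul]; exact Submodule.zero_mem _
  | add x y _ _ hx hy => rw [add_mul]; exact Submodule.add_mem _ hx hy
  | smul c x _ hx => rw [smul_mul_assoc]; exact Submodule.smul_mem _ _ hx

theorem domainSpan_mul_mem_left (hτ : IsWeight τ) (hu : IsUnitarilyInvariant τ) {a : A}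
    (ha : a ∈ domainSpan τ) (b : A) : b * a ∈ domainSpan τ := by
  induction ha using Submodule.span_induction with
  | mem a h =>
    obtain ⟨h0, h⟩ := h
    have hs := isSquareFinite_sqrt h0 h
    have : b * a = star (CFC.sqrt a * star b) * CFC.sqrt a := by
      conv_lhs => rw [← sqrt_mul_sqrt_eq_star_mul h0]
      rw [star_mul, star_star, mul_assoc]
    rw [this]
    exact (hs.mul_right hτ hu _).star_mul_mem hτ hs
  | zero => rw [mul_zero]; exact Submodule.zero_mem _
  | add x y _ _ hx hy => rw [mul_add]; exact Submodule.add_mem _ hx hy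
  | smul c x _ hx => rw [mul_smul_comm]; exact Submodule.smul_mem _ _ hx

/-- The graph of the linear extension of `τ` to the span of its domain: `x = p - q + i (r - s)` and
`z = τ p - τ q + i (τ r - τ s)` with `p, q, r, s` in the domain. -/
def ExtensionGraph (τ : PosCone A → ℝ≥0∞) (x : A) (z : ℂ) : Prop :=
  ∃ p q r s : PosCone A, τ p < ∞ ∧ τ q < ∞ ∧ τ r < ∞ ∧ τ s < ∞ ∧
    x = p.1 - q.1 + Complex.I • (r.1 - s.1) ∧
    z = ((τ p).toReal - (τ q).toReal : ℝ) + Complex.I * ((τ r).toReal - (τ s).toReal : ℝ)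

theorem IsWeight.toReal_add (hτ : IsWeight τ) {a b : PosCone A} (ha : τ a < ∞) (hb : τ b < ∞) :
    (τ (a + b)).toReal = (τ a).toReal + (τ b).toReal := by
  rw [hτ.map_add, ENNReal.toReal_add ha.ne hb.ne]

/-- Equality of two decompositions `p - q` is an equality of sums in the cone, on which `τ` is
additive. -/
theorem ExtensionGraph.unique (hτ : IsWeight τ) {x : A} {z w : ℂ} (hz : ExtensionGraph τ x z)
    (hw : ExtensionGraph τ x w) : z = w := by
  obtain ⟨p, q, r, s, hp, hq, hr, hs, rfl, rfl⟩ := hz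
  obtain ⟨p', q', r', s', hp', hq', hr', hs', hx, rfl⟩ := hw
  have hsa : ∀ a b : PosCone A, IsSelfAdjoint (a.1 - b.1) := fun a b =>
    (IsSelfAdjoint.of_nonneg a.2).sub (.of_nonneg b.2)
  have hx' := congrArg star hx
  simp only [star_add, star_smul, (hsa _ _).star_eq, RCLike.star_def, Complex.conj_I] at hx'
  have h1 : p.1 + q'.1 = p'.1 + q.1 := by
    have := congrArg₂ (· + ·) hx hx'
    have h2 : (2 : ℂ) • (p.1 - q.1) = (2 : ℂ) • (p'.1 - q'.1) := by
      simp only [neg_smul] at this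
      rw [two_smul, two_smul]
      calc _ = p.1 - q.1 + Complex.I • (r.1 - s.1) + (p.1 - q.1 + -(Complex.I • (r.1 - s.1))) := by
            abel
        _ = _ := this
        _ = _ := by abel
    have h3 := smul_right_injective A (two_ne_zero (α := ℂ)) h2
    rw [sub_eq_sub_iff_add_eq_add] at h3
    exact h3
  have h1' : r.1 + s'.1 = r'.1 + s.1 := by
    have h2 : p.1 - q.1 = p'.1 - q'.1 := sub_eq_sub_iff_add_eq_add.2 h1
    rw [h2] at hx
    have h3 := smul_right_injective A Complex.I_ne_zero (add_left_cancel hx)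
    exact sub_eq_sub_iff_add_eq_add.1 h3
  have e1 : p + q' = p' + q := Subtype.ext h1
  have e2 : r + s' = r' + s := Subtype.ext h1'
  have e1 := congrArg (fun a => (τ a).toReal) e1
  have e2 := congrArg (fun a => (τ a).toReal) e2
  simp only [hτ.toReal_add hp hq', hτ.toReal_add hp' hq, hτ.toReal_add hr hs',
    hτ.toReal_add hr' hs] at e1 e2
  rw [show (τ p).toReal - (τ q).toReal = (τ p').toReal - (τ q').toReal by linarith,
    show (τ r).toReal - (τ s).toReal = (τ r').toReal - (τ s').toReal by linarith]

theorem ExtensionGraph.add (hτ : IsWeight τ) {x y : A} {z w : ℂ} (hz : ExtensionGraph τ x z)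
    (hw : ExtensionGraph τ y w) : ExtensionGraph τ (x + y) (z + w) := by
  obtain ⟨p, q, r, s, hp, hq, hr, hs, rfl, rfl⟩ := hz
  obtain ⟨p', q', r', s', hp', hq', hr', hs', rfl, rfl⟩ := hw
  refine ⟨p + p', q + q', r + r', s + s', hτ.add_lt_top hp hp', hτ.add_lt_top hq hq',
    hτ.add_lt_top hr hr', hτ.add_lt_top hs hs', ?_, ?_⟩
  · change _ = (p.1 + p'.1) - (q.1 + q'.1) + Complex.I • ((r.1 + r'.1) - (s.1 + s'.1))
    module
  · rw [hτ.toReal_add hp hp', hτ.toReal_add hq hq', hτ.toReal_add hr hr', hτ.toReal_add hs hs']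
    push_cast
    ring

theorem ExtensionGraph.nnreal_smul (hτ : IsWeight τ) {x : A} {z : ℂ} (hz : ExtensionGraph τ x z)
    (c : ℝ≥0) : ExtensionGraph τ ((c : ℂ) • x) (c * z) := by
  obtain ⟨p, q, r, s, hp, hq, hr, hs, rfl, rfl⟩ := hz
  refine ⟨posSMul c p, posSMul c q, posSMul c r, posSMul c s, hτ.smul_lt_top c hp,
    hτ.smul_lt_top c hq, hτ.smul_lt_top c hr, hτ.smul_lt_top c hs, ?_, ?_⟩
  · simp only [posSMul, ← Complex.coe_smul]
    module
  · simp only [hτ.map_smul, ENNReal.toReal_mul, ENNReal.coe_toReal]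
    push_cast
    ring

theorem ExtensionGraph.I_smul {x : A} {z : ℂ} (hz : ExtensionGraph τ x z) :
    ExtensionGraph τ (Complex.I • x) (Complex.I * z) := by
  obtain ⟨p, q, r, s, hp, hq, hr, hs, rfl, rfl⟩ := hz
  refine ⟨s, r, p, q, hs, hr, hp, hq, ?_, ?_⟩
  · match_scalars <;> simp
  · push_cast
    linear_combination ((τ r).toReal - (τ s).toReal : ℂ) * Complex.I_mul_I

theorem ExtensionGraph.neg {x : A} {z : ℂ} (hz : ExtensionGraph τ x z) :
    ExtensionGraph τ (-x) (-z) := by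
  have := hz.I_smul.I_smul
  rwa [smul_smul, ← mul_assoc, Complex.I_mul_I, neg_one_mul, neg_one_smul] at this

theorem ExtensionGraph.real_smul (hτ : IsWeight τ) {x : A} {z : ℂ} (hz : ExtensionGraph τ x z)
    (c : ℝ) : ExtensionGraph τ ((c : ℂ) • x) (c * z) := by
  rcases le_total 0 c with hc | hc
  · lift c to ℝ≥0 using hc
    exact hz.nnreal_smul hτ c
  · obtain ⟨d, rfl⟩ : ∃ d : ℝ, c = -d := ⟨-c, by simp⟩
    lift d to ℝ≥0 using by linarith
    simpa using (hz.nnreal_smul hτ d).neg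

theorem ExtensionGraph.smul (hτ : IsWeight τ) {x : A} {z : ℂ} (hz : ExtensionGraph τ x z)
    (c : ℂ) : ExtensionGraph τ (c • x) (c * z) := by
  have := (hz.real_smul hτ c.re).add hτ (hz.real_smul hτ c.im).I_smul
  rw [smul_smul, ← add_smul, ← mul_assoc, ← add_mul, mul_comm Complex.I, Complex.re_add_im] at this
  exact this

theorem extensionGraph_of_lt_top (hτ : IsWeight τ) {a : PosCone A} (ha : τ a < ∞) :
    ExtensionGraph τ a.1 ((τ a).toReal : ℂ) := by
  have h0 : τ 0 < ∞ := by rw [hτ.map_zero]; exact ENNReal.zero_lt_top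
  exact ⟨a, 0, 0, 0, ha, h0, h0, h0, by
    change a.1 = a.1 - 0 + Complex.I • ((0 : A) - 0); simp, by simp [hτ.map_zero]⟩

theorem exists_extensionGraph (hτ : IsWeight τ) {x : A} (hx : x ∈ domainSpan τ) :
    ∃ z, ExtensionGraph τ x z := by
  induction hx using Submodule.span_induction with
  | mem a h =>
    obtain ⟨h0, h⟩ := h
    exact ⟨_, extensionGraph_of_lt_top hτ (a := ⟨a, h0⟩) h⟩
  | zero =>
    have h0 : τ 0 < ∞ := by rw [hτ.map_zero]; exact ENNReal.zero_lt_top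
    exact ⟨_, extensionGraph_of_lt_top hτ (a := 0) h0⟩
  | add x y _ _ hx hy =>
    obtain ⟨z, hz⟩ := hx
    obtain ⟨w, hw⟩ := hy
    exact ⟨_, hz.add hτ hw⟩
  | smul c x _ hx =>
    obtain ⟨z, hz⟩ := hx
    exact ⟨_, hz.smul hτ c⟩

theorem exists_extension (hτ : IsWeight τ) : ∃ f : domainSpan τ →ₗ[ℂ] ℂ, Extends τ f := by
  choose F hF using fun x : domainSpan τ => exists_extensionGraph hτ x.2
  refine ⟨⟨⟨F, fun x y => ?_⟩, fun c x => ?_⟩, fun a ha => ?_⟩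
  · exact (hF (x + y)).unique hτ ((hF x).add hτ (hF y))
  · exact (hF (c • x)).unique hτ ((hF x).smul hτ c)
  · exact (hF _).unique hτ (extensionGraph_of_lt_top hτ ha)

theorem Extends.unique {f g : domainSpan τ →ₗ[ℂ] ℂ} (hf : Extends τ f) (hg : Extends τ g) :
    f = g := by
  ext ⟨x, hx⟩
  induction hx using Submodule.span_induction with
  | mem a h =>
    obtain ⟨h0, h⟩ := h
    exact (hf ⟨a, h0⟩ h).trans (hg ⟨a, h0⟩ h).symm
  | zero => exact (map_zero f).trans (map_zero g).symm
  | add x y hx hy h1 h2 =>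
    have := congrArg₂ (· + ·) h1 h2
    rwa [← map_add, ← map_add] at this
  | smul c x hx h =>
    have := congrArg (c * ·) h
    simp only [← smul_eq_mul, ← map_smul] at this
    exact this

theorem IsUnitarilyInvariant.eq (hu : IsUnitarilyInvariant τ) {u : A} (hu' : u ∈ unitary A)
    (a : PosCone A) : τ (adConj u a) = τ a := by
  refine le_antisymm (hu u hu' a) ?_
  have := hu (star u) (Unitary.star_mem hu') (adConj u a)
  rwa [adConj_adConj, Unitary.star_mul_self_of_mem hu', adConj_one] at this

theorem Extends.conj_eq (hτ : IsWeight τ) (hu : IsUnitarilyInvariant τ)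
    {f : domainSpan τ →ₗ[ℂ] ℂ} (hf : Extends τ f) {u : A} (hu' : u ∈ unitary A) {a : A}
    (ha : a ∈ domainSpan τ) :
    f ⟨u * a * star u, domainSpan_mul_mem_right hτ hu (domainSpan_mul_mem_left hτ hu ha u) _⟩ =
      f ⟨a, ha⟩ := by
  induction ha using Submodule.span_induction with
  | mem a h =>
    obtain ⟨h0, h⟩ := h
    have h1 := hu.eq hu' ⟨a, h0⟩
    have h2 := hf (adConj u ⟨a, h0⟩) (h1 ▸ h)
    exact h2.trans ((congrArg (fun t : ℝ≥0∞ => (t.toReal : ℂ)) h1).trans (hf ⟨a, h0⟩ h).symm)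
  | zero => congr 2; simp
  | add x y hx hy h1 h2 =>
    have := congrArg₂ (· + ·) h1 h2
    rw [← map_add, ← map_add] at this
    convert this using 3
    · simp [mul_add, add_mul]
    · rfl
  | smul c x hx h =>
    have := congrArg (c * ·) h
    simp only [← smul_eq_mul, ← map_smul] at this
    convert this using 3
    · simp
    · rfl

/-- It suffices to commute with unitaries, which span `A`; and `f(a u) = f(u (a u) u*) = f(u a)`. -/
theorem Extends.mul_comm (hτ : IsWeight τ) (hu : IsUnitarilyInvariant τ)
    {f : domainSpan τ →ₗ[ℂ] ℂ} (hf : Extends τ f) {a : A} (ha : a ∈ domainSpan τ) (b : A) :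
    f ⟨a * b, domainSpan_mul_mem_right hτ hu ha b⟩ =
      f ⟨b * a, domainSpan_mul_mem_left hτ hu ha b⟩ := by
  have hb : b ∈ Submodule.span ℂ (unitary A : Set A) := by
    rw [CStarAlgebra.span_unitary]; trivial
  induction hb using Submodule.span_induction with
  | mem u hu' =>
    rw [← hf.conj_eq hτ hu hu' (domainSpan_mul_mem_right hτ hu ha u)]
    congr 2
    rw [mul_assoc, mul_assoc, Unitary.mul_star_self_of_mem hu', mul_one]
  | zero => congr 2; simp
  | add x y _ _ h1 h2 =>
    have := congrArg₂ (· + ·) h1 h2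
    rw [← map_add, ← map_add] at this
    convert this using 3
    · simp [mul_add]
    · simp [add_mul]
  | smul c x _ h =>
    have := congrArg (c * ·) h
    simp only [← smul_eq_mul, ← map_smul] at this
    convert this using 3
    · simp
    · simp

theorem isTracial_of_isUnitarilyInvariant (hτ : IsWeight τ) (hu : IsUnitarilyInvariant τ) :
    IsTracial τ where
  mul_mem_right _ ha b := domainSpan_mul_mem_right hτ hu ha b
  mul_mem_left _ ha b := domainSpan_mul_mem_left hτ hu ha b
  existsUnique_extension :=
    let ⟨f, hf⟩ := exists_extension hτ
    ⟨f, hf, fun _ hg => hg.unique hf⟩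
  trace_comm _ hf _ ha b := hf.mul_comm hτ hu ha b

end Tracial

/-! ### The semifinite regularization of a trace -/

section Semifinite

set_option linter.unusedSectionVars false

variable {A : Type*} [CStarAlgebra A] [PartialOrder A] [StarOrderedRing A]
  {τ : PosCone A → ℝ≥0∞}

theorem IsSquareFinite.lt_top {x y : A} (hx : IsSquareFinite τ x) (h : star x * x = y)
    (hy : 0 ≤ y) : τ ⟨y, hy⟩ < ∞ := by
  subst h; exact hx

theorem conj_lt_top (hτ : IsWeight τ) (hu : IsUnitarilyInvariant τ) {a : PosCone A}
    (ha : τ a < ∞) (g : A) : τ (adConj g a) < ∞ := by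
  refine ((isSquareFinite_sqrt a.2 ha).mul_right hτ hu (star g)).lt_top ?_ _
  rw [star_mul, star_star, mul_assoc, ← mul_assoc (star _), sqrt_mul_sqrt_eq_star_mul a.2,
    ← mul_assoc]

/-- With `h = x x*` and `k = (h + ε)^{-1/2}`, the elements `x* (k h k) x` tend to `x* x`. They lie
in the ideal, and there `τ(x* (k h k) x) = τ(k h k h) = τ(h) - ε τ(k h k)`. -/
theorem map_star_mul_self_le (hτ : IsWeight τ) (hlsc : LowerSemicontinuous τ)
    (hu : IsUnitarilyInvariant τ) (x : A) :
    τ ⟨star x * x, star_mul_self_nonneg x⟩ ≤ τ ⟨x * star x, mul_star_self_nonneg x⟩ := by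
  rcases eq_or_ne (τ ⟨x * star x, mul_star_self_nonneg x⟩) ∞ with htop | htop
  · rw [htop]; exact le_top
  set h : PosCone A := ⟨x * star x, mul_star_self_nonneg x⟩ with hh
  have hfin : τ h < ∞ := lt_top_iff_ne_top.2 htop
  refine le_of_forall_lt fun t ht => ?_
  obtain ⟨η, hη, H⟩ := Metric.eventually_nhds_iff.1 (hlsc _ t ht)
  obtain ⟨k, hk, hcomm, hk1⟩ := exists_inv_sqrt h.2 (half_pos hη)
  have hle1 : k * h.1 * k ≤ 1 := by
    rw [← hk1]
    refine hk.conjugate_le_conjugate (le_add_of_nonneg_right ?_)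
    rw [Algebra.algebraMap_eq_smul_one]
    exact smul_nonneg (half_pos hη).le zero_le_one
  have hknn : 0 ≤ k * h.1 * k := hk.conjugate_nonneg h.2
  set F : PosCone A := ⟨star x * (k * h.1 * k) * x, star_left_conjugate_nonneg hknn x⟩ with hF
  have hFt : t < τ F := H <| by
    rw [Subtype.dist_eq, dist_eq_norm]
    exact (norm_conj_inv_sqrt_sub_le hk (half_pos hη).le hk1 hle1).trans_lt (half_lt_self hη)
  refine hFt.trans_le ?_
  have hFfin : τ F < ∞ := by
    refine ((isSquareFinite_sqrt h.2 hfin).mul_right hτ hu (k * x)).lt_top ?_ _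
    rw [star_mul, star_mul, hk.star_eq, mul_assoc, ← mul_assoc (star _),
      sqrt_mul_sqrt_eq_star_mul h.2]
    simp only [mul_assoc]
  have hkfin : τ ⟨k * h.1 * k, hknn⟩ < ∞ := by
    have := conj_lt_top hτ hu hfin k
    simpa only [adConj, hk.star_eq] using this
  obtain ⟨f, hf⟩ := exists_extension hτ
  have hmem : h.1 ∈ domainSpan τ := mem_domainSpan h.2 hfin
  have hmem' : k * h.1 * k * x ∈ domainSpan τ := domainSpan_mul_mem_right hτ hu
    (domainSpan_mul_mem_right hτ hu (domainSpan_mul_mem_left hτ hu hmem k) k) x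
  have e1 : k * h.1 * k * x * star x = h.1 - ((η / 2 : ℝ) : ℂ) • (k * h.1 * k) := by
    have h3 : k * h.1 * k = 1 - (η / 2) • (k * k) := by
      rw [← hk1, Algebra.algebraMap_eq_smul_one]
      simp [mul_add, add_mul]
    calc k * h.1 * k * x * star x = k * h.1 * k * h.1 := by rw [hh]; simp only [mul_assoc]
      _ = h.1 - (η / 2) • (k * (k * h.1)) := by
        rw [h3, sub_mul, one_mul, smul_mul_assoc, mul_assoc]
      _ = _ := by
        rw [show k * (k * h.1) = k * h.1 * k by rw [mul_assoc, ← hcomm.eq], Complex.coe_smul]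
  have e2 := hf.mul_comm hτ hu hmem' (star x)
  have e3 : f ⟨k * h.1 * k * x * star x, domainSpan_mul_mem_right hτ hu hmem' _⟩ =
      f ⟨h.1, hmem⟩ - ((η / 2 : ℝ) : ℂ) * f ⟨k * h.1 * k, mem_domainSpan hknn hkfin⟩ := by
    have e0 : (⟨k * h.1 * k * x * star x, domainSpan_mul_mem_right hτ hu hmem' _⟩ : domainSpan τ) =
        ⟨h.1, hmem⟩ - ((η / 2 : ℝ) : ℂ) • ⟨k * h.1 * k, mem_domainSpan hknn hkfin⟩ :=
      Subtype.ext e1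
    rw [e0, map_sub, map_smul, smul_eq_mul]
  have e4 : f ⟨star x * (k * h.1 * k * x), domainSpan_mul_mem_left hτ hu hmem' _⟩ =
      ((τ F).toReal : ℂ) := by
    rw [← hf F hFfin]
    congr 1
    exact Subtype.ext (by simp only [hF, mul_assoc])
  rw [← e2, e3] at e4
  have e5 := hf h hfin
  have e6 := hf ⟨_, hknn⟩ hkfin
  rw [e5, e6] at e4
  have e7 : (τ F).toReal = (τ h).toReal - η / 2 * (τ ⟨k * h.1 * k, hknn⟩).toReal := by
    exact_mod_cast e4.symm
  rw [← ENNReal.toReal_le_toReal hFfin.ne hfin.ne, e7]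
  have := mul_nonneg (half_pos hη).le (ENNReal.toReal_nonneg (a := τ ⟨k * h.1 * k, hknn⟩))
  linarith

theorem semifiniteReg_le (hτ : IsWeight τ) (a : PosCone A) : semifiniteReg τ a ≤ τ a :=
  iSup_le fun _ => iSup₂_le fun h _ => hτ.mono h

theorem le_semifiniteReg {a b : PosCone A} (h : b ≤ a) (hb : τ b < ∞) :
    τ b ≤ semifiniteReg τ a :=
  le_iSup_of_le b (le_iSup₂_of_le h hb le_rfl)

theorem semifiniteReg_eq_of_lt_top (hτ : IsWeight τ) {a : PosCone A} (ha : τ a < ∞) :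
    semifiniteReg τ a = τ a :=
  le_antisymm (semifiniteReg_le hτ a) (le_semifiniteReg le_rfl ha)

theorem semifiniteReg_mono {a b : PosCone A} (h : a ≤ b) :
    semifiniteReg τ a ≤ semifiniteReg τ b :=
  iSup_le fun _ => iSup₂_le fun hc hfin => le_semifiniteReg (hc.trans h) hfin

theorem semifiniteReg_eq_iSup_subtype (a : PosCone A) :
    semifiniteReg τ a = ⨆ b : {b : PosCone A // b ≤ a ∧ τ b < ∞}, τ b.1 :=
  le_antisymm
    (iSup_le fun b => iSup₂_le fun h hb => le_iSup_of_le
      (⟨b, h, hb⟩ : {b : PosCone A // b ≤ a ∧ τ b < ∞}) le_rfl)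
    (iSup_le fun b => le_semifiniteReg b.2.1 b.2.2)

theorem le_semifiniteReg_add (hτ : IsWeight τ) (a₁ a₂ : PosCone A) :
    semifiniteReg τ a₁ + semifiniteReg τ a₂ ≤ semifiniteReg τ (a₁ + a₂) := by
  have h0 : τ 0 < ∞ := by rw [hτ.map_zero]; exact ENNReal.zero_lt_top
  have hne : ∀ a : PosCone A, Nonempty {b : PosCone A // b ≤ a ∧ τ b < ∞} := fun a =>
    ⟨⟨0, a.2, h0⟩⟩
  have := hne a₁
  have := hne a₂
  rw [semifiniteReg_eq_iSup_subtype, semifiniteReg_eq_iSup_subtype]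
  refine ENNReal.iSup_add_iSup_le fun b₁ b₂ => ?_
  rw [← hτ.map_add]
  exact le_semifiniteReg (add_le_add (show b₁.1.1 ≤ a₁.1 from b₁.2.1) b₂.2.1)
    (hτ.add_lt_top b₁.2.2 b₂.2.2)

/-- If `b ≤ a = a₁ + a₂` has finite trace, then `b` is the limit of the sums `x₁* x₁ + x₂* x₂`, where
`xᵢ = aᵢ^{1/2} (a + ε)^{-1/2} b^{1/2}` satisfies `xᵢ xᵢ* ≤ aᵢ`. -/
theorem semifiniteReg_add_le (hτ : IsWeight τ) (hlsc : LowerSemicontinuous τ)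
    (hu : IsUnitarilyInvariant τ) (a₁ a₂ : PosCone A) :
    semifiniteReg τ (a₁ + a₂) ≤ semifiniteReg τ a₁ + semifiniteReg τ a₂ := by
  refine iSup_le fun b => iSup₂_le fun hba hb => le_of_forall_lt fun t ht => ?_
  obtain ⟨η, hη, H⟩ := Metric.eventually_nhds_iff.1 (hlsc b t ht)
  obtain ⟨k, hk, -, hk1⟩ := exists_inv_sqrt (a₁ + a₂).2 (half_pos hη)
  set s := CFC.sqrt b.1 with hs
  have hss : IsSelfAdjoint s := .of_nonneg (CFC.sqrt_nonneg b.1)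
  have hsb : s * s = b.1 := CFC.sqrt_mul_sqrt_self b.1 b.2
  have hkb : k * b.1 * k ≤ 1 := by
    rw [← hk1]
    refine hk.conjugate_le_conjugate (le_add_of_le_of_nonneg
      (show b.1 ≤ (a₁ + a₂).1 from hba) ?_)
    rw [Algebra.algebraMap_eq_smul_one]
    exact smul_nonneg (half_pos hη).le zero_le_one
  have hnn : ∀ a : PosCone A, 0 ≤ s * (k * a.1 * k) * s := fun a =>
    hss.conjugate_nonneg (hk.conjugate_nonneg a.2)
  -- each of the two summands is dominated by the regularization
  have key : ∀ a : PosCone A, τ ⟨s * (k * a.1 * k) * s, hnn a⟩ ≤ semifiniteReg τ a := fun a => by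
    set r := CFC.sqrt a.1 with hr
    have hrs : IsSelfAdjoint r := .of_nonneg (CFC.sqrt_nonneg a.1)
    have hrr : r * r = a.1 := CFC.sqrt_mul_sqrt_self a.1 a.2
    set x := r * k * s with hx
    have hxs : star x = s * k * r := by
      rw [hx, star_mul, star_mul, hss.star_eq, hk.star_eq, hrs.star_eq, mul_assoc]
    have hxx : star x * x = s * (k * a.1 * k) * s := by
      rw [hxs, hx, ← hrr]; simp only [mul_assoc]
    have hxx' : x * star x = r * (k * b.1 * k) * r := by
      rw [hxs, hx, ← hsb]; simp only [mul_assoc]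
    have h1 := map_star_mul_self_le hτ hlsc hu x
    have h2 := map_star_mul_self_le hτ hlsc hu (star x)
    simp only [star_star] at h2
    have h3 : τ ⟨star x * x, star_mul_self_nonneg x⟩ < ∞ :=
      (isSquareFinite_sqrt b.2 hb).mul_left hτ (r * k)
    have h4 : x * star x ≤ a.1 := by
      rw [hxx']
      refine (hrs.conjugate_le_conjugate hkb).trans (le_of_eq ?_)
      rw [mul_one, hrr]
    have h5 := le_semifiniteReg (τ := τ) (a := a) (b := ⟨x * star x, mul_star_self_nonneg x⟩) h4
      (h2.trans_lt h3)
    refine le_trans (le_of_eq ?_) (h1.trans h5)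
    congr 1
    exact Subtype.ext hxx.symm
  have hlt := H (y := ⟨s * (k * (a₁ + a₂).1 * k) * s, hnn _⟩) (by
    rw [Subtype.dist_eq, dist_eq_norm]
    have := norm_conj_inv_sqrt_sub_le (y := s) hk (half_pos hη).le hk1
      (by rw [hss.star_eq, hsb]; exact hkb)
    rw [hss.star_eq, hsb] at this
    exact this.trans_lt (half_lt_self hη))
  have hadd : (⟨s * (k * (a₁ + a₂).1 * k) * s, hnn _⟩ : PosCone A) =
      ⟨s * (k * a₁.1 * k) * s, hnn _⟩ + ⟨s * (k * a₂.1 * k) * s, hnn _⟩ := by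
    refine Subtype.ext ?_
    change s * (k * (a₁.1 + a₂.1) * k) * s = s * (k * a₁.1 * k) * s + s * (k * a₂.1 * k) * s
    simp only [mul_add, add_mul]
  rw [hadd, hτ.map_add] at hlt
  exact hlt.trans_le (add_le_add (key a₁) (key a₂))

theorem posSMul_mono (r : ℝ≥0) {a b : PosCone A} (h : a ≤ b) : posSMul r a ≤ posSMul r b :=
  smul_le_smul_of_nonneg_left (show a.1 ≤ b.1 from h) r.2

theorem isWeight_semifiniteReg (hτ : IsWeight τ) (hlsc : LowerSemicontinuous τ)
    (hu : IsUnitarilyInvariant τ) : IsWeight (semifiniteReg τ) where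
  map_add a b := le_antisymm (semifiniteReg_add_le hτ hlsc hu a b) (le_semifiniteReg_add hτ a b)
  map_smul r a := by
    have hle : ∀ (r : ℝ≥0) (a : PosCone A), r * semifiniteReg τ a ≤ semifiniteReg τ (posSMul r a) :=
      fun r a => by
        simp only [semifiniteReg, ENNReal.mul_iSup]
        refine iSup_le fun b => iSup₂_le fun h hb => ?_
        rw [← hτ.map_smul]
        exact le_semifiniteReg (posSMul_mono r h) (hτ.smul_lt_top r hb)
    refine le_antisymm ?_ (hle r a)
    rcases eq_or_ne r 0 with rfl | hr
    · have h0 : posSMul 0 a = 0 := Subtype.ext (zero_smul ℝ a.1)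
      refine (semifiniteReg_le hτ _).trans ?_
      rw [h0, hτ.map_zero]
      exact zero_le
    · have h1 := hle r⁻¹ (posSMul r a)
      have h2 : posSMul r⁻¹ (posSMul r a) = a := Subtype.ext <| by
        change ((r⁻¹ : ℝ≥0) : ℝ) • (r : ℝ) • a.1 = a.1
        rw [smul_smul, NNReal.coe_inv, inv_mul_cancel₀ (by exact_mod_cast hr), one_smul]
      rw [h2, ENNReal.coe_inv hr, mul_comm, ← div_eq_mul_inv,
        ENNReal.div_le_iff_le_mul (.inl (by simpa)) (.inl (by simp)), mul_comm] at h1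
      exact h1

/-- If `b ≤ a` and `a'` is close to `a`, then the compression of `b` under `a'` is close to `b`. -/
theorem lowerSemicontinuous_semifiniteReg (hτ : IsWeight τ) (hlsc : LowerSemicontinuous τ)
    (hu : IsUnitarilyInvariant τ) : LowerSemicontinuous (semifiniteReg τ) := by
  intro a t ht
  simp only [semifiniteReg, lt_iSup_iff] at ht
  obtain ⟨b, hba, hb, htb⟩ := ht
  obtain ⟨η, hη, H⟩ := Metric.eventually_nhds_iff.1 (hlsc b t htb)
  obtain ⟨ε, hε, Hε⟩ := exists_compression (A := A) ‖b.1‖ hη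
  filter_upwards [Metric.ball_mem_nhds a hε] with a' ha'
  obtain ⟨g, hg, hgc⟩ := Hε a'.1 a'.2
  have hle : b.1 ≤ a'.1 + algebraMap ℝ A ε := by
    refine (show b.1 ≤ a.1 from hba).trans ?_
    rw [Metric.mem_ball', Subtype.dist_eq, dist_eq_norm] at ha'
    rw [← sub_le_iff_le_add']
    exact ((IsSelfAdjoint.of_nonneg a.2).sub
      (.of_nonneg a'.2)).le_algebraMap_norm_self.trans (algebraMap_mono A ha'.le)
  obtain ⟨h1, h2⟩ := hgc b.1 b.2 hle
  have hval : (adConj g b).1 = g * b.1 * g := by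
    change g * b.1 * star g = _
    rw [hg.star_eq]
  have h3 : t < τ (adConj g b) := H (by
    rw [Subtype.dist_eq, dist_eq_norm, hval]; exact h2 le_rfl)
  refine h3.trans_le (le_semifiniteReg ?_ (conj_lt_top hτ hu hb g))
  change (adConj g b).1 ≤ a'.1
  rwa [hval]

theorem isUnitarilyInvariant_semifiniteReg (hu : IsUnitarilyInvariant τ) :
    IsUnitarilyInvariant (semifiniteReg τ) := by
  intro u hu' a
  refine iSup_le fun b => iSup₂_le fun h hb => ?_
  have hb' := hu.eq (Unitary.star_mem hu') b
  rw [← hb']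
  refine le_semifiniteReg ?_ (hb' ▸ hb)
  have := adConj_mono (star u) h
  rwa [adConj_adConj, Unitary.star_mul_self_of_mem hu', adConj_one] at this

theorem isSemifinite_semifiniteReg (hτ : IsWeight τ) : IsSemifinite (semifiniteReg τ) := by
  intro a
  refine le_antisymm ?_ (iSup_le fun b => iSup₂_le fun h _ => semifiniteReg_mono h)
  refine iSup_le fun b => iSup₂_le fun h hb => ?_
  have := semifiniteReg_eq_of_lt_top hτ hb
  refine le_iSup_of_le b (le_iSup₂_of_le h ?_ this.ge)
  rwa [this]

end Semifinite

/-! ### The trace of positive operators, limit states and boundary layers -/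

section PosTrace

set_option linter.unusedSectionVars false

variable {H : Type*} [NormedAddCommGroup H] [InnerProductSpace ℂ H] [CompleteSpace H]

theorem posTrace_add {S T : H →L[ℂ] H} (hS : 0 ≤ S) (hT : 0 ≤ T) :
    posTrace (S + T) = posTrace S + posTrace T := by
  rw [ContinuousLinearMap.nonneg_iff_isPositive] at hS hT
  rw [posTrace, posTrace, posTrace, ← ENNReal.tsum_add]
  refine tsum_congr fun e => ?_
  rw [add_apply, inner_add_right, Complex.add_re,
    ENNReal.ofReal_add]
  · exact hS.re_inner_nonneg_right _
  · exact hT.re_inner_nonneg_right _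

theorem posTrace_smul (r : ℝ≥0) (T : H →L[ℂ] H) :
    posTrace ((r : ℝ) • T) = r * posTrace T := by
  rw [posTrace, posTrace, ← ENNReal.tsum_mul_left]
  refine tsum_congr fun e => ?_
  rw [smul_apply, ← Complex.coe_smul, inner_smul_right, Complex.re_ofReal_mul,
    ENNReal.ofReal_mul (p := (r : ℝ)) r.2, ENNReal.ofReal_coe_nnreal]

theorem posTrace_mono {S T : H →L[ℂ] H} (hS : 0 ≤ S) (h : S ≤ T) : posTrace S ≤ posTrace T := by
  have : T = S + (T - S) := (add_sub_cancel S T).symm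
  rw [this, posTrace_add hS (sub_nonneg.2 h)]
  exact le_self_add

theorem posTrace_star_mul_self (X : H →L[ℂ] H) : posTrace (star X * X) =
    ∑' e : (exists_hilbertBasis ℂ H).choose, ENNReal.ofReal (‖X e‖ ^ 2) := by
  refine tsum_congr fun e => ?_
  rw [mul_apply_eq_comp, ContinuousLinearMap.star_eq_adjoint,
    ContinuousLinearMap.adjoint_inner_right, inner_self_eq_norm_sq_to_K]
  norm_cast

theorem ofReal_norm_sq_eq_tsum {ι : Type*} (b : HilbertBasis ι ℂ H) (v : H) :
    ENNReal.ofReal (‖v‖ ^ 2) = ∑' i, ENNReal.ofReal (‖⟪b i, v⟫_ℂ‖ ^ 2) := by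
  have h := Complex.hasSum_re (b.hasSum_inner_mul_inner v v)
  have h1 : ∀ i, (⟪v, b i⟫_ℂ * ⟪b i, v⟫_ℂ).re = ‖⟪b i, v⟫_ℂ‖ ^ 2 := fun i => by
    rw [← inner_conj_symm v, ← Complex.normSq_eq_conj_mul_self, Complex.ofReal_re,
      Complex.normSq_eq_norm_sq]
  have h2 : (⟪v, v⟫_ℂ).re = ‖v‖ ^ 2 := inner_self_eq_norm_sq (𝕜 := ℂ) v
  simp only [h1, h2] at h
  rw [← h.tsum_eq, ENNReal.ofReal_tsum_of_nonneg (fun i => by positivity) h.summable]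

/-- `Tr(X* X) = Tr(X X*)`, by Parseval's identity. -/
theorem posTrace_star_mul_self_comm (X : H →L[ℂ] H) :
    posTrace (star X * X) = posTrace (X * star X) := by
  obtain ⟨b, hb⟩ := (exists_hilbertBasis ℂ H).choose_spec
  have h2 := posTrace_star_mul_self (star X)
  rw [star_star] at h2
  rw [posTrace_star_mul_self, h2]
  simp only [ofReal_norm_sq_eq_tsum b, hb]
  rw [ENNReal.tsum_comm]
  refine tsum_congr fun e => tsum_congr fun f => ?_
  rw [ContinuousLinearMap.star_eq_adjoint, ContinuousLinearMap.adjoint_inner_right,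
    norm_inner_symm]

end PosTrace

section LimState

variable {ω : (BoundedContinuousFunction ℕ ℂ) →ₗ[ℂ] ℂ}

theorem limState_eq (a : ℕ → ℝ) (B : BoundedContinuousFunction ℕ ℂ) (h : ∀ n, B n = a n) :
    limState ω a = (ω B).re := by
  have h' : ∃ C : ℝ, ∀ n, ‖(a n : ℂ)‖ ≤ C := ⟨‖B‖, fun n => h n ▸ B.norm_coe_le_norm n⟩
  rw [limState, dif_pos h']
  congr 2
  ext n
  exact (h n).symm

theorem exists_boundedContinuousFunction {a : ℕ → ℝ} {C : ℝ} (h : ∀ᶠ n in atTop, |a n| ≤ C) :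
    ∃ B : BoundedContinuousFunction ℕ ℂ, ∀ n, B n = a n := by
  obtain ⟨C', hC'⟩ : ∃ C' : ℝ, ∀ n, ‖(a n : ℂ)‖ ≤ C' := by
    obtain ⟨N, hN⟩ := eventually_atTop.1 h
    refine ⟨max C (∑ i ∈ Finset.range N, |a i|), fun n => ?_⟩
    rw [Complex.norm_real, Real.norm_eq_abs]
    rcases le_or_gt N n with hn | hn
    · exact le_max_of_le_left (hN n hn)
    · exact le_max_of_le_right (Finset.single_le_sum (f := fun i => |a i|)
        (fun i _ => abs_nonneg _) (Finset.mem_range.2 hn))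
  exact ⟨BoundedContinuousFunction.ofNormedAddCommGroupDiscrete (fun n => (a n : ℂ)) C' hC',
    fun n => rfl⟩

theorem limState_nonneg (hω : IsLimitState ω) {a : ℕ → ℝ} (ha : ∀ n, 0 ≤ a n) :
    0 ≤ limState ω a := by
  rw [limState]
  split_ifs with h
  · exact (Complex.le_def.1 (hω.nonneg _ fun n => Complex.zero_le_real.2 (ha n))).1
  · exact le_rfl

theorem limState_add {a b : ℕ → ℝ} {C D : ℝ} (ha : ∀ᶠ n in atTop, |a n| ≤ C)
    (hb : ∀ᶠ n in atTop, |b n| ≤ D) :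
    limState ω (fun n => a n + b n) = limState ω a + limState ω b := by
  obtain ⟨A, hA⟩ := exists_boundedContinuousFunction ha
  obtain ⟨B, hB⟩ := exists_boundedContinuousFunction hb
  rw [limState_eq a A hA, limState_eq b B hB, limState_eq _ (A + B) fun n => by simp [hA, hB],
    map_add, Complex.add_re]

theorem limState_const_mul {a : ℕ → ℝ} {C : ℝ} (ha : ∀ᶠ n in atTop, |a n| ≤ C) (r : ℝ) :
    limState ω (fun n => r * a n) = r * limState ω a := by
  obtain ⟨A, hA⟩ := exists_boundedContinuousFunction ha
  rw [limState_eq a A hA, limState_eq _ ((r : ℂ) • A) fun n => by simp [hA], map_smul,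
    smul_eq_mul, Complex.re_ofReal_mul]

/-- The difference is replaced by its positive part, which is a null sequence. -/
theorem limState_le_of_eventually_le (hω : IsLimitState ω) {a b d : ℕ → ℝ} {C D : ℝ}
    (ha : ∀ᶠ n in atTop, |a n| ≤ C) (hb : ∀ᶠ n in atTop, |b n| ≤ D)
    (hd : Tendsto d atTop (𝓝 0)) (h : ∀ᶠ n in atTop, a n ≤ b n + d n) :
    limState ω a ≤ limState ω b := by
  obtain ⟨A, hA⟩ := exists_boundedContinuousFunction ha
  obtain ⟨B, hB⟩ := exists_boundedContinuousFunction hb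
  have hz : Tendsto (fun n => max (a n - b n) 0) atTop (𝓝 0) := by
    have hd' : Tendsto (fun n => |d n|) atTop (𝓝 0) := by simpa using hd.abs
    refine squeeze_zero' (.of_forall fun n => le_max_right _ _) ?_ hd'
    filter_upwards [h] with n hn
    exact max_le ((sub_le_iff_le_add'.2 hn).trans (le_abs_self _)) (abs_nonneg _)
  obtain ⟨Z, hZ⟩ := exists_boundedContinuousFunction (a := fun n => max (a n - b n) 0) (C := 1)
    (by
      have := hz.abs
      rw [abs_zero] at this
      exact this.eventually_le_const one_pos)
  have hZ0 : ω Z = 0 := hω.map_null Z (by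
    rw [show (Z : ℕ → ℂ) = fun n => ((max (a n - b n) 0 : ℝ) : ℂ) from funext hZ]
    exact_mod_cast (Complex.continuous_ofReal.tendsto 0).comp hz)
  have hnn := hω.nonneg (B + Z - A) fun n => by
    have : (B + Z - A) n = ((b n + max (a n - b n) 0 - a n : ℝ) : ℂ) := by
      simp [hA, hB, hZ]
    rw [this]
    refine Complex.zero_le_real.2 ?_
    have := le_max_left (a n - b n) 0
    linarith
  rw [map_sub, map_add, hZ0, add_zero] at hnn
  have := (Complex.le_def.1 hnn).1
  rw [limState_eq a A hA, limState_eq b B hB]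
  simpa using this

end LimState

section Layers

variable {M : Type*} [MetricSpace M]

theorem innerPenumbra_subset {r : ℝ} {K : Set M} (hK : IsClosed K) : innerPenumbra r K ⊆ K :=
  closure_minimal (compl_subset_comm.1 (Metric.self_subset_cthickening Kᶜ)) hK

/-- A thickened boundary layer is contained in a wider one. -/
theorem cthickening_layer_subset {u r₁ r₂ : ℝ} (hu : 0 < u) (hr₁ : 0 < r₁) (hr₂ : 0 < r₂)
    (K : Set M) :
    Metric.cthickening u (Metric.cthickening r₁ K \ innerPenumbra r₂ K) ⊆
      Metric.cthickening (u + r₁) K \ innerPenumbra (r₂ + u + 1) K := by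
  intro x hx
  refine ⟨Metric.cthickening_cthickening_subset hu.le hr₁.le K
    (Metric.cthickening_subset_of_subset u sdiff_subset hx), fun hx' => ?_⟩
  obtain ⟨x', hx', hd⟩ := Metric.mem_closure_iff.1 hx' (1 / 4) (by norm_num)
  have h1 : Metric.infEDist x (Metric.cthickening r₁ K \ innerPenumbra r₂ K) <
      ENNReal.ofReal (u + 1 / 4) :=
    lt_of_le_of_lt hx ((ENNReal.ofReal_lt_ofReal_iff (by positivity)).2 (by linarith))
  obtain ⟨y, hy, hxy⟩ := Metric.infEDist_lt_iff.1 h1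
  refine hy.2 (subset_closure fun hy' => hx' ?_)
  rw [Metric.mem_cthickening_iff] at hy' ⊢
  have hd' : edist x' x ≤ ENNReal.ofReal (1 / 4) := by
    rw [edist_comm, edist_dist]
    exact ENNReal.ofReal_le_ofReal hd.le
  calc Metric.infEDist x' Kᶜ ≤ edist x' y + Metric.infEDist y Kᶜ := by
        rw [add_comm]; exact Metric.infEDist_le_infEDist_add_edist
    _ ≤ (edist x' x + edist x y) + Metric.infEDist y Kᶜ := by gcongr; exact edist_triangle _ _ _
    _ ≤ (ENNReal.ofReal (1 / 4) + ENNReal.ofReal (u + 1 / 4)) + ENNReal.ofReal r₂ := by gcongr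
    _ = ENNReal.ofReal (1 / 4 + (u + 1 / 4) + r₂) := by
      rw [← ENNReal.ofReal_add (by positivity) (by positivity),
        ← ENNReal.ofReal_add (by positivity) (by positivity)]
    _ ≤ _ := ENNReal.ofReal_le_ofReal (by linarith)

end Layers

/-! ### The measures `μ_T` and finite propagation -/

section Roe

set_option linter.unusedSectionVars false

variable {M : Type*} [MetricSpace M] [ProperSpace M] [MeasurableSpace M] [BorelSpace M]
variable {V : Type*} [NormedAddCommGroup V] [NormedSpace ℂ V] [FiniteDimensional ℂ V]
  {F : M → Type*} [TopologicalSpace (TotalSpace V F)]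
  [∀ x, NormedAddCommGroup (F x)] [∀ x, InnerProductSpace ℂ (F x)]
  [FiberBundle V F] [VectorBundle ℂ V F] [IsHermitianBundle V F] {vol : Measure M}

theorem isSelfAdjoint_cutoff {Ω : Set M} (hΩ : MeasurableSet Ω) :
    IsSelfAdjoint (cutoff V F vol Ω) :=
  ContinuousLinearMap.isSelfAdjoint_iff_isSymmetric.2 fun f g => inner_cutoff hΩ f g

theorem norm_cutoff_sq_add {Ω Ω' : Set M} (hΩ : MeasurableSet Ω) (hΩ' : MeasurableSet Ω')
    (f : L2 V F vol) :
    ‖cutoff V F vol Ω f‖ ^ 2 =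
      ‖cutoff V F vol (Ω ∩ Ω') f‖ ^ 2 + ‖cutoff V F vol (Ω \ Ω') f‖ ^ 2 := by
  have h1 := cutoff_add_compl hΩ' (cutoff V F vol Ω f)
  rw [cutoff_cutoff hΩ' hΩ, cutoff_cutoff hΩ'.compl hΩ, inter_comm Ω', inter_comm Ω'ᶜ,
    ← sdiff_eq] at h1
  have h2 : ⟪cutoff V F vol (Ω ∩ Ω') f, cutoff V F vol (Ω \ Ω') f⟫_ℂ = 0 := by
    rw [inner_cutoff (hΩ.inter hΩ'), cutoff_cutoff (hΩ.inter hΩ') (hΩ.diff hΩ'),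
      show Ω ∩ Ω' ∩ (Ω \ Ω') = ∅ by ext x; simp; tauto, cutoff_empty, inner_zero_right]
  have h3 := norm_add_sq_eq_norm_sq_add_norm_sq_of_inner_eq_zero _ _ h2
  rw [h1] at h3
  simpa only [sq] using h3

/-- Diagonalizing `T = Y Y*` moves the cutoff outside: `μ_T(Ω) = Σ ‖E_Ω Y e‖²`. -/
theorem traceMeasure_mul_star (Y : L2 V F vol →L[ℂ] L2 V F vol) {Ω : Set M}
    (hΩ : MeasurableSet Ω) :
    traceMeasure (Y * star Y) Ω = ∑' e : (exists_hilbertBasis ℂ (L2 V F vol)).choose,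
      ENNReal.ofReal (‖cutoff V F vol Ω (Y e)‖ ^ 2) := by
  have hE := (isSelfAdjoint_cutoff (V := V) (F := F) (vol := vol) hΩ).star_eq
  have h1 : cutoff V F vol Ω * (Y * star Y) * cutoff V F vol Ω =
      (cutoff V F vol Ω * Y) * star (cutoff V F vol Ω * Y) := by
    rw [star_mul, hE]; simp only [mul_assoc]
  rw [traceMeasure, h1, ← posTrace_star_mul_self_comm, posTrace_star_mul_self]
  rfl

theorem exists_eq_mul_star {T : L2 V F vol →L[ℂ] L2 V F vol} (hT : 0 ≤ T) :
    ∃ Y : L2 V F vol →L[ℂ] L2 V F vol, T = Y * star Y :=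
  ⟨CFC.sqrt T, by
    rw [(IsSelfAdjoint.of_nonneg (CFC.sqrt_nonneg T)).star_eq, CFC.sqrt_mul_sqrt_self T]⟩

theorem traceMeasure_inter_add_diff {T : L2 V F vol →L[ℂ] L2 V F vol} (hT : 0 ≤ T)
    {Ω Ω' : Set M} (hΩ : MeasurableSet Ω) (hΩ' : MeasurableSet Ω') :
    traceMeasure T (Ω ∩ Ω') + traceMeasure T (Ω \ Ω') = traceMeasure T Ω := by
  obtain ⟨Y, rfl⟩ := exists_eq_mul_star hT
  rw [traceMeasure_mul_star Y hΩ, traceMeasure_mul_star Y (hΩ.inter hΩ'),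
    traceMeasure_mul_star Y (hΩ.diff hΩ'), ← ENNReal.tsum_add]
  refine tsum_congr fun e => ?_
  rw [norm_cutoff_sq_add hΩ hΩ', ENNReal.ofReal_add (by positivity) (by positivity)]

theorem traceMeasure_mono_set {T : L2 V F vol →L[ℂ] L2 V F vol} (hT : 0 ≤ T)
    {Ω Ω' : Set M} (hΩ : MeasurableSet Ω) (hΩ' : MeasurableSet Ω') (h : Ω ⊆ Ω') :
    traceMeasure T Ω ≤ traceMeasure T Ω' := by
  rw [← traceMeasure_inter_add_diff hT hΩ' hΩ, inter_eq_right.2 h]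
  exact le_self_add

theorem conj_cutoff_nonneg {T : L2 V F vol →L[ℂ] L2 V F vol} (hT : 0 ≤ T) {Ω : Set M}
    (hΩ : MeasurableSet Ω) : 0 ≤ cutoff V F vol Ω * T * cutoff V F vol Ω :=
  (isSelfAdjoint_cutoff hΩ).conjugate_nonneg hT

theorem traceMeasure_mono {S T : L2 V F vol →L[ℂ] L2 V F vol} (hS : 0 ≤ S) (h : S ≤ T)
    {Ω : Set M} (hΩ : MeasurableSet Ω) : traceMeasure S Ω ≤ traceMeasure T Ω :=
  posTrace_mono (conj_cutoff_nonneg hS hΩ) ((isSelfAdjoint_cutoff hΩ).conjugate_le_conjugate h)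

theorem traceMeasure_add {S T : L2 V F vol →L[ℂ] L2 V F vol} (hS : 0 ≤ S) (hT : 0 ≤ T)
    {Ω : Set M} (hΩ : MeasurableSet Ω) :
    traceMeasure (S + T) Ω = traceMeasure S Ω + traceMeasure T Ω := by
  rw [traceMeasure, mul_add, add_mul,
    posTrace_add (conj_cutoff_nonneg hS hΩ) (conj_cutoff_nonneg hT hΩ)]
  rfl

theorem traceMeasure_smul (r : ℝ≥0) (T : L2 V F vol →L[ℂ] L2 V F vol) (Ω : Set M) :
    traceMeasure ((r : ℝ) • T) Ω = r * traceMeasure T Ω := by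
  rw [traceMeasure, mul_smul_comm, smul_mul_assoc, posTrace_smul]
  rfl

/-- An operator of propagation `u` applied over `Ω` only sees the `u`-neighbourhood of `Ω`. -/
theorem HasFinitePropagation.exists_cutoff_eq {x : L2 V F vol →L[ℂ] L2 V F vol}
    (hx : HasFinitePropagation x) : ∃ u : ℝ, 0 < u ∧ ∀ Ω : Set M, MeasurableSet Ω →
      IsCompact (closure Ω) → ∀ f : L2 V F vol,
        cutoff V F vol Ω (x f) = cutoff V F vol Ω (x (cutoff V F vol (Metric.cthickening u Ω) f)) := by
  obtain ⟨u, hu, h⟩ := hasFinitePropagation_star hx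
  refine ⟨u, hu, fun Ω hΩ hc f => ?_⟩
  have hm : MeasurableSet (Metric.cthickening u Ω) := Metric.isClosed_cthickening.measurableSet
  have hzero : cutoff V F vol Ω (x (cutoff V F vol (Metric.cthickening u Ω)ᶜ f)) = 0 := by
    refine ext_inner_right ℂ fun g => ?_
    have hg : essSupport (cutoff V F vol Ω g) ⊆ closure Ω := by
      rw [essSupport_subset_iff isClosed_closure,
        cutoff_cutoff isClosed_closure.isOpen_compl.measurableSet hΩ,
        show (closure Ω)ᶜ ∩ Ω = ∅ from
          (disjoint_compl_left_iff_subset.2 subset_closure).inter_eq]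
      exact cutoff_empty _
    have h1 := h _ hc _ hg
    rw [Metric.cthickening_closure, essSupport_subset_iff Metric.isClosed_cthickening] at h1
    rw [inner_cutoff hΩ, ← ContinuousLinearMap.adjoint_inner_right,
      ← ContinuousLinearMap.star_eq_adjoint, inner_cutoff hm.compl, h1, inner_zero_right,
      inner_zero_left]
  conv_lhs => rw [← cutoff_add_compl hm f, map_add, map_add, hzero, add_zero]

theorem HasFinitePropagation.exists_traceMeasure_conj_le {x : L2 V F vol →L[ℂ] L2 V F vol}
    (hx : HasFinitePropagation x) : ∃ u : ℝ, 0 < u ∧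
      ∀ T : L2 V F vol →L[ℂ] L2 V F vol, 0 ≤ T → ∀ Ω : Set M, MeasurableSet Ω →
        IsCompact (closure Ω) → traceMeasure (x * T * star x) Ω ≤
          ENNReal.ofReal (‖x‖ ^ 2) * traceMeasure T (Metric.cthickening u Ω) := by
  obtain ⟨u, hu, h⟩ := hx.exists_cutoff_eq
  refine ⟨u, hu, fun T hT Ω hΩ hc => ?_⟩
  obtain ⟨Y, rfl⟩ := exists_eq_mul_star hT
  have h1 : x * (Y * star Y) * star x = (x * Y) * star (x * Y) := by
    rw [star_mul]; simp only [mul_assoc]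
  rw [h1, traceMeasure_mul_star _ hΩ,
    traceMeasure_mul_star _ Metric.isClosed_cthickening.measurableSet, ← ENNReal.tsum_mul_left]
  refine ENNReal.tsum_le_tsum fun e => ?_
  rw [← ENNReal.ofReal_mul (by positivity), ← mul_pow, mul_apply_eq_comp, h Ω hΩ hc]
  refine ENNReal.ofReal_le_ofReal (pow_le_pow_left₀ (norm_nonneg _) ?_ 2)
  exact (norm_cutoff_le hΩ _).trans (x.le_opNorm _)

/-! ### Roe's functional and its cone -/

variable {K : ℕ → Set M}

theorem measurableSet_layer (r₁ r₂ : ℝ) (S : Set M) :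
    MeasurableSet (Metric.cthickening r₁ S \ innerPenumbra r₂ S) :=
  Metric.isClosed_cthickening.measurableSet.diff isClosed_closure.measurableSet

theorem MemRoeCone.mono {S T : L2 V F vol →L[ℂ] L2 V F vol} (hK : ∀ n, IsCompact (K n))
    (hT : MemRoeCone K T) (hS : 0 ≤ S) (h : S ≤ T) : MemRoeCone K S where
  nonneg := hS
  locallyTraceClass C hC :=
    (traceMeasure_mono hS h hC.measurableSet).trans_lt (hT.locallyTraceClass C hC)
  bounded := by
    obtain ⟨c, hc, hev⟩ := hT.bounded
    exact ⟨c, hc, hev.mono fun n hn => (traceMeasure_mono hS h (hK n).measurableSet).trans hn⟩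
  boundary r₁ r₂ h₁ h₂ := tendsto_of_tendsto_of_tendsto_of_le_of_le tendsto_const_nhds
    (hT.boundary r₁ r₂ h₁ h₂) (fun n => zero_le)
    (fun n => ENNReal.div_le_div_right (traceMeasure_mono hS h (measurableSet_layer _ _ _)) _)

theorem MemRoeCone.add {S T : L2 V F vol →L[ℂ] L2 V F vol} (hK : ∀ n, IsCompact (K n))
    (hS : MemRoeCone K S) (hT : MemRoeCone K T) : MemRoeCone K (S + T) where
  nonneg := add_nonneg hS.nonneg hT.nonneg
  locallyTraceClass C hC := by
    rw [traceMeasure_add hS.nonneg hT.nonneg hC.measurableSet]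
    exact ENNReal.add_lt_top.2 ⟨hS.locallyTraceClass C hC, hT.locallyTraceClass C hC⟩
  bounded := by
    obtain ⟨c, hc, hev⟩ := hS.bounded
    obtain ⟨d, hd, hev'⟩ := hT.bounded
    refine ⟨c + d, by positivity, ?_⟩
    filter_upwards [hev, hev'] with n h1 h2
    rw [traceMeasure_add hS.nonneg hT.nonneg (hK n).measurableSet, ENNReal.coe_add, add_mul]
    exact add_le_add h1 h2
  boundary r₁ r₂ h₁ h₂ := by
    simp only [traceMeasure_add hS.nonneg hT.nonneg (measurableSet_layer _ _ _), ENNReal.add_div]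
    simpa using (hS.boundary r₁ r₂ h₁ h₂).add (hT.boundary r₁ r₂ h₁ h₂)

set_option synthInstance.maxHeartbeats 200000 in
theorem MemRoeCone.smul {T : L2 V F vol →L[ℂ] L2 V F vol} (hT : MemRoeCone K T) (r : ℝ≥0) :
    MemRoeCone K ((r : ℝ) • T) where
  nonneg := smul_nonneg r.2 hT.nonneg
  locallyTraceClass C hC := by
    rw [traceMeasure_smul]
    exact ENNReal.mul_lt_top ENNReal.coe_lt_top (hT.locallyTraceClass C hC)
  bounded := by
    obtain ⟨c, hc, hev⟩ := hT.bounded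
    refine ⟨r * c + 1, by positivity, ?_⟩
    filter_upwards [hev] with n h1
    rw [traceMeasure_smul, ENNReal.coe_add, add_mul, ENNReal.coe_mul, mul_assoc]
    exact (mul_le_mul_right h1 _).trans le_self_add
  boundary r₁ r₂ h₁ h₂ := by
    simp only [traceMeasure_smul, mul_div_assoc]
    simpa using ENNReal.Tendsto.const_mul (hT.boundary r₁ r₂ h₁ h₂)
      (.inr (ENNReal.coe_ne_top (r := r)))

set_option synthInstance.maxHeartbeats 200000 in
theorem memRoeCone_zero : MemRoeCone K (0 : L2 V F vol →L[ℂ] L2 V F vol) := by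
  have h0 : ∀ Ω, traceMeasure (0 : L2 V F vol →L[ℂ] L2 V F vol) Ω = 0 := fun Ω => by
    simpa using traceMeasure_smul (0 : ℝ≥0) (0 : L2 V F vol →L[ℂ] L2 V F vol) Ω
  exact ⟨le_rfl, fun C _ => by simp [h0], ⟨1, one_pos, .of_forall fun n => by simp [h0]⟩,
    fun r₁ r₂ _ _ => by simp [h0]⟩

/-- The inner penumbra of `S` is contained in `S`, so the layer covers the part of the
`u`-neighbourhood outside `S`. -/
theorem traceMeasure_cthickening_le {T : L2 V F vol →L[ℂ] L2 V F vol} (hT : 0 ≤ T) {S : Set M}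
    (hS : IsCompact S) (u : ℝ) : traceMeasure T (Metric.cthickening u S) ≤
      traceMeasure T S + traceMeasure T (Metric.cthickening u S \ innerPenumbra 1 S) := by
  rw [← traceMeasure_inter_add_diff hT Metric.isClosed_cthickening.measurableSet hS.measurableSet]
  have hm : MeasurableSet (Metric.cthickening u S) := Metric.isClosed_cthickening.measurableSet
  refine add_le_add (traceMeasure_mono_set hT (hm.inter hS.measurableSet) hS.measurableSet
    inter_subset_right) (traceMeasure_mono_set hT (hm.diff hS.measurableSet)
      (measurableSet_layer _ _ _) (sdiff_subset_sdiff_right (innerPenumbra_subset hS.isClosed)))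

/-- On the cone of Roe's functional, conjugation by a finite propagation operator multiplies
`μ_T(K n)` by at most the square of the norm, up to the mass of a boundary layer. -/
theorem MemRoeCone.conj {x T : L2 V F vol →L[ℂ] L2 V F vol} (hK : ∀ n, IsCompact (K n))
    (hx : HasFinitePropagation x) (hT : MemRoeCone K T) :
    MemRoeCone K (x * T * star x) ∧ ∃ u : ℝ, 0 < u ∧ ∀ n,
      traceMeasure (x * T * star x) (K n) ≤ ENNReal.ofReal (‖x‖ ^ 2) * (traceMeasure T (K n) +
        traceMeasure T (Metric.cthickening u (K n) \ innerPenumbra 1 (K n))) := by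
  obtain ⟨u, hu, H⟩ := hx.exists_traceMeasure_conj_le
  have hle : ∀ n, traceMeasure (x * T * star x) (K n) ≤ ENNReal.ofReal (‖x‖ ^ 2) *
      (traceMeasure T (K n) +
        traceMeasure T (Metric.cthickening u (K n) \ innerPenumbra 1 (K n))) := fun n =>
    (H T hT.nonneg _ (hK n).measurableSet (by rw [(hK n).isClosed.closure_eq]; exact hK n)).trans
      (mul_le_mul_right (traceMeasure_cthickening_le hT.nonneg (hK n) u) _)
  refine ⟨⟨star_right_conjugate_nonneg hT.nonneg x, fun C hC => ?_, ?_, fun r₁ r₂ h₁ h₂ => ?_⟩,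
    u, hu, hle⟩
  · refine (H T hT.nonneg C hC.measurableSet (by rwa [hC.isClosed.closure_eq])).trans_lt ?_
    exact ENNReal.mul_lt_top ENNReal.ofReal_lt_top (hT.locallyTraceClass _ hC.cthickening)
  · obtain ⟨c, hc, hev⟩ := hT.bounded
    have hlayer := (hT.boundary u 1 hu one_pos).eventually_le_const one_pos
    refine ⟨(‖x‖ ^ 2).toNNReal * (c + 1) + 1, by positivity, ?_⟩
    filter_upwards [hev, hlayer] with n h1 h2
    rw [ENNReal.div_le_iff_le_mul (.inr ENNReal.one_ne_top) (.inr one_ne_zero), one_mul] at h2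
    refine (hle n).trans ?_
    rw [ENNReal.coe_add, add_mul, ENNReal.coe_mul, mul_assoc, ENNReal.coe_add, add_mul,
      ENNReal.coe_one, one_mul]
    refine le_trans ?_ le_self_add
    exact mul_le_mul_right (add_le_add h1 h2) _
  · have hlim := ENNReal.Tendsto.const_mul (a := ENNReal.ofReal (‖x‖ ^ 2))
      (hT.boundary (u + r₁) (r₂ + u + 1) (by positivity) (by positivity))
      (.inr ENNReal.ofReal_ne_top)
    rw [mul_zero] at hlim
    refine tendsto_of_tendsto_of_tendsto_of_le_of_le tendsto_const_nhds hlim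
      (fun n => zero_le) (fun n => ?_)
    have hcl : IsCompact (closure (Metric.cthickening r₁ (K n) \ innerPenumbra r₂ (K n))) :=
      (hK n).cthickening.of_isClosed_subset isClosed_closure
        (closure_minimal sdiff_subset Metric.isClosed_cthickening)
    have h1 := H T hT.nonneg _ (measurableSet_layer r₁ r₂ (K n)) hcl
    have h2 := traceMeasure_mono_set hT.nonneg Metric.isClosed_cthickening.measurableSet
      (measurableSet_layer _ _ _) (cthickening_layer_subset hu h₁ h₂ (K n))
    change _ ≤ ENNReal.ofReal (‖x‖ ^ 2) * (_ / _)
    rw [← mul_div_assoc]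
    exact ENNReal.div_le_div_right (h1.trans (mul_le_mul_right h2 _)) _

theorem MemRoeCone.exists_abs_ratio_le {T : L2 V F vol →L[ℂ] L2 V F vol}
    (hT : MemRoeCone K T) :
    ∃ C : ℝ, ∀ᶠ n in atTop, |(traceMeasure T (K n) / vol (K n)).toReal| ≤ C := by
  obtain ⟨c, -, hev⟩ := hT.bounded
  refine ⟨c, hev.mono fun n hn => ?_⟩
  rw [abs_of_nonneg ENNReal.toReal_nonneg]
  exact ENNReal.toReal_le_coe_of_le_coe (ENNReal.div_le_of_le_mul hn)

variable {ω : (BoundedContinuousFunction ℕ ℂ) →ₗ[ℂ] ℂ}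

theorem roeFunctional_of_mem {T : L2 V F vol →L[ℂ] L2 V F vol} (hT : MemRoeCone K T) :
    roeFunctional K ω T =
      ENNReal.ofReal (limState ω fun n => (traceMeasure T (K n) / vol (K n)).toReal) :=
  if_pos hT

theorem roeFunctional_of_notMem {T : L2 V F vol →L[ℂ] L2 V F vol} (hT : ¬ MemRoeCone K T) :
    roeFunctional K ω T = ∞ :=
  if_neg hT

theorem roeFunctional_add (hK : ∀ n, IsCompact (K n)) (hω : IsLimitState ω)
    {S T : L2 V F vol →L[ℂ] L2 V F vol} (hS : 0 ≤ S) (hT : 0 ≤ T) :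
    roeFunctional K ω (S + T) = roeFunctional K ω S + roeFunctional K ω T := by
  by_cases hS' : MemRoeCone K S
  swap
  · rw [roeFunctional_of_notMem hS', top_add, roeFunctional_of_notMem fun h =>
      hS' (h.mono hK hS (le_add_of_nonneg_right hT))]
  by_cases hT' : MemRoeCone K T
  swap
  · rw [roeFunctional_of_notMem hT', add_top, roeFunctional_of_notMem fun h =>
      hT' (h.mono hK hT (le_add_of_nonneg_left hS))]
  obtain ⟨C, hC⟩ := hS'.exists_abs_ratio_le
  obtain ⟨D, hD⟩ := hT'.exists_abs_ratio_le
  rw [roeFunctional_of_mem hS', roeFunctional_of_mem hT', roeFunctional_of_mem (hS'.add hK hT'),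
    ← ENNReal.ofReal_add (limState_nonneg hω fun n => ENNReal.toReal_nonneg)
      (limState_nonneg hω fun n => ENNReal.toReal_nonneg), ← limState_add hC hD]
  congr 2
  ext n
  rw [traceMeasure_add hS hT (hK n).measurableSet, ENNReal.toReal_div, ENNReal.toReal_div,
    ENNReal.toReal_div, ENNReal.toReal_add (hS'.locallyTraceClass _ (hK n)).ne
      (hT'.locallyTraceClass _ (hK n)).ne, add_div]

theorem roeFunctional_smul_of_mem {T : L2 V F vol →L[ℂ] L2 V F vol}
    (hT : MemRoeCone K T) (r : ℝ≥0) :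
    roeFunctional K ω ((r : ℝ) • T) = r * roeFunctional K ω T := by
  obtain ⟨C, hC⟩ := hT.exists_abs_ratio_le
  rw [roeFunctional_of_mem hT, roeFunctional_of_mem (hT.smul r)]
  simp only [traceMeasure_smul, mul_div_assoc, ENNReal.toReal_mul, ENNReal.coe_toReal]
  rw [limState_const_mul hC, ENNReal.ofReal_mul (p := (r : ℝ)) r.2, ENNReal.ofReal_coe_nnreal]

set_option synthInstance.maxHeartbeats 200000 in
theorem roeFunctional_smul (T : L2 V F vol →L[ℂ] L2 V F vol) (r : ℝ≥0) :
    roeFunctional K ω ((r : ℝ) • T) = r * roeFunctional K ω T := by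
  by_cases hT : MemRoeCone K T
  · exact roeFunctional_smul_of_mem hT r
  rcases eq_or_ne r 0 with rfl | hr
  · simpa using roeFunctional_smul_of_mem (ω := ω)
      (memRoeCone_zero (K := K) (V := V) (F := F) (vol := vol)) 0
  rw [roeFunctional_of_notMem hT, ENNReal.mul_top (by simpa), roeFunctional_of_notMem]
  intro h
  have := h.smul r⁻¹
  rw [smul_smul, NNReal.coe_inv, inv_mul_cancel₀ (by exact_mod_cast hr), one_smul] at this
  exact hT this

theorem isWeight_roeWeight (hK : ∀ n, IsCompact (K n)) (hω : IsLimitState ω) :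
    IsWeight (roeWeight K ω : PosCone (almostLocal V F vol) → ℝ≥0∞) where
  map_add a b := roeFunctional_add hK hω a.2 b.2
  map_smul r _ := roeFunctional_smul _ r

theorem roeFunctional_conj_le (hK : ∀ n, IsCompact (K n)) (hω : IsLimitState ω)
    {x T : L2 V F vol →L[ℂ] L2 V F vol} (hx : HasFinitePropagation x)
    (hT : roeFunctional K ω T < ∞) :
    roeFunctional K ω (x * T * star x) ≤ ENNReal.ofReal (‖x‖ ^ 2) * roeFunctional K ω T := by
  have hT : MemRoeCone K T := by
    by_contra h
    exact hT.ne (roeFunctional_of_notMem h)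
  obtain ⟨hxT, u, hu, hle⟩ := hT.conj hK hx
  obtain ⟨C, hC⟩ := hT.exists_abs_ratio_le
  obtain ⟨D, hD⟩ := hxT.exists_abs_ratio_le
  rw [roeFunctional_of_mem hT, roeFunctional_of_mem hxT, ← ENNReal.ofReal_mul (by positivity),
    ← limState_const_mul hC]
  refine ENNReal.ofReal_le_ofReal (limState_le_of_eventually_le hω hD
    (D := ‖x‖ ^ 2 * C) ?_ (d := fun n => ‖x‖ ^ 2 * (traceMeasure T
      (Metric.cthickening u (K n) \ innerPenumbra 1 (K n)) / vol (K n)).toReal) ?_ ?_)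
  · filter_upwards [hC] with n hn
    rw [abs_mul, abs_of_nonneg (by positivity : 0 ≤ ‖x‖ ^ 2)]
    gcongr
  · have := (ENNReal.tendsto_toReal ENNReal.zero_ne_top).comp (hT.boundary u 1 hu one_pos)
    simpa using this.const_mul (‖x‖ ^ 2)
  · refine .of_forall fun n => ?_
    have h1 : traceMeasure T (K n) < ∞ := hT.locallyTraceClass _ (hK n)
    have h2 : traceMeasure T (Metric.cthickening u (K n) \ innerPenumbra 1 (K n)) < ∞ :=
      (traceMeasure_mono_set hT.nonneg (measurableSet_layer _ _ _)
        Metric.isClosed_cthickening.measurableSet sdiff_subset).trans_lt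
        (hT.locallyTraceClass _ (hK n).cthickening)
    have h3 := ENNReal.toReal_mono (ENNReal.mul_ne_top ENNReal.ofReal_ne_top
      (ENNReal.add_lt_top.2 ⟨h1, h2⟩).ne) (hle n)
    rw [ENNReal.toReal_mul, ENNReal.toReal_ofReal (by positivity),
      ENNReal.toReal_add h1.ne h2.ne] at h3
    simp only [ENNReal.toReal_div]
    rw [← mul_add, ← add_div, ← mul_div_assoc]
    gcongr

theorem dense_finitePropagation :
    Dense {v : almostLocal V F vol | HasFinitePropagation (v : L2 V F vol →L[ℂ] L2 V F vol)} := by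
  rw [Subtype.dense_iff]
  intro x hx
  refine closure_mono ?_ (show x ∈ closure (finitePropagation V F vol : Set _) from hx)
  intro y hy
  exact ⟨⟨y, subset_closure hy⟩, hy, rfl⟩

theorem IsDeltaUnitary.norm_sq_le {A : Type*} [CStarAlgebra A] {δ : ℝ} {v : A}
    (hv : IsDeltaUnitary δ v) : ‖v‖ ^ 2 ≤ 1 + δ := by
  have h1 : ‖(1 : A)‖ ≤ 1 := by
    have h := CStarRing.norm_self_mul_star (x := (1 : A))
    rw [star_one, mul_one] at h
    nlinarith [norm_nonneg (1 : A)]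
  rw [sq, ← CStarRing.norm_star_mul_self]
  have h2 := norm_add_le (star v * v - 1) 1
  rw [sub_add_cancel] at h2
  linarith [hv.1]

/-- A finite propagation operator `v` close to a unitary has `‖v‖² ≤ 1 + ε`, so conjugation by it
increases the weight at most by the factor `1 + ε`. -/
theorem isUnitarilyInvariant_semicontReg_roeWeight (hK : ∀ n, IsCompact (K n))
    (hω : IsLimitState ω) : IsUnitarilyInvariant
      (semicontReg (roeWeight K ω : PosCone (almostLocal V F vol) → ℝ≥0∞)) := by
  have hτ := isWeight_roeWeight (V := V) (F := F) (vol := vol) hK hω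
  have hlsc := lowerSemicontinuous_semicontReg
    (roeWeight K ω : PosCone (almostLocal V F vol) → ℝ≥0∞)
  refine isUnitarilyInvariant_of_dense hlsc dense_finitePropagation fun u hu ε hε => ?_
  filter_upwards [eventually_isDeltaUnitary hu hε] with v hv hvS a
  refine le_semicontReg_of_comp_le hτ hlsc
    (continuous_adConj.comp (Continuous.prodMk_right v)) (c := (1 + ε).toNNReal)
    (fun b hb => (semicontReg_le _ _).trans ((roeFunctional_conj_le hK hω hvS hb).trans ?_)) ?_ a
  · gcongr
    · exact ENNReal.ofReal_le_ofReal hv.norm_sq_le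
    · exact le_rfl
  · have : 0 < 1 + ε := by linarith
    simpa using this

end Roe

end RoeTrace

theorem proposition3p3p4 :
    -- weights on a unital C*-algebra
    (∀ (A : Type*) [CStarAlgebra A] [PartialOrder A] [StarOrderedRing A]
      (τ₀ : RoeTrace.PosCone A → ℝ≥0∞), RoeTrace.IsWeight τ₀ →
      -- the semicontinuous regularization of any weight
      RoeTrace.IsWeight (RoeTrace.semicontReg τ₀) ∧
      LowerSemicontinuous (RoeTrace.semicontReg τ₀) ∧
      (RoeTrace.semicontReg τ₀ = τ₀ ↔ LowerSemicontinuous τ₀) ∧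
      (∀ a, τ₀ a < ∞ → RoeTrace.semicontReg τ₀ a < ∞) ∧
      -- weights that are ε-invariant under the δ-unitaries of a dense *-subalgebra
      (∀ A₀ : NonUnitalStarSubalgebra ℂ A, Dense (A₀ : Set A) →
        RoeTrace.IsEpsInvariant A₀ τ₀ →
        RoeTrace.IsEpsInvariant A₀ (RoeTrace.semicontReg τ₀) ∧
        RoeTrace.IsTracial (RoeTrace.semicontReg τ₀))) ∧
    -- Roe's functional on the C*-algebra of almost local operators
    (∀ (M : Type*) [MetricSpace M] [ProperSpace M] [MeasurableSpace M] [BorelSpace M]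
      (vol : Measure M) [IsFiniteMeasureOnCompacts vol]
      (V : Type*) [NormedAddCommGroup V] [NormedSpace ℂ V] [FiniteDimensional ℂ V]
      (F : M → Type*) [TopologicalSpace (TotalSpace V F)]
      [∀ x, NormedAddCommGroup (F x)] [∀ x, InnerProductSpace ℂ (F x)]
      [FiberBundle V F] [VectorBundle ℂ V F] [RoeTrace.IsHermitianBundle V F]
      (K : ℕ → Set M) (_ : RoeTrace.IsRegularExhaustion vol K)
      (ω : (BoundedContinuousFunction ℕ ℂ) →ₗ[ℂ] ℂ) (_ : RoeTrace.IsLimitState ω)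
      (φ τ tr : RoeTrace.PosCone (RoeTrace.almostLocal V F vol) → ℝ≥0∞)
      (_ : φ = RoeTrace.roeWeight K ω) (_ : τ = RoeTrace.semicontReg φ)
      (_ : tr = RoeTrace.roeTrace K ω),
      RoeTrace.IsWeight φ ∧
      -- its semicontinuous regularization is a semicontinuous trace
      RoeTrace.IsWeight τ ∧ LowerSemicontinuous τ ∧ RoeTrace.IsTracial τ ∧
      -- the regularized functional is a semicontinuous semifinite trace
      RoeTrace.IsWeight tr ∧ LowerSemicontinuous tr ∧ RoeTrace.IsTracial tr ∧
      RoeTrace.IsSemifinite tr ∧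
      (∀ a, tr a ≤ τ a) ∧ (∀ a, τ a < ∞ → tr a = τ a)) := by
  refine ⟨fun A _ _ _ τ₀ hτ => ⟨RoeTrace.isWeight_semicontReg hτ,
    RoeTrace.lowerSemicontinuous_semicontReg τ₀, RoeTrace.semicontReg_eq_self_iff hτ,
    fun a ha => (RoeTrace.semicontReg_le τ₀ a).trans_lt ha, fun A₀ hA₀ hinv => ?_⟩, ?_⟩
  · have hinv' := RoeTrace.isEpsInvariant_semicontReg hτ hinv
    exact ⟨hinv', RoeTrace.isTracial_of_isUnitarilyInvariant (RoeTrace.isWeight_semicontReg hτ)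
      (hinv'.isUnitarilyInvariant (RoeTrace.lowerSemicontinuous_semicontReg τ₀) hA₀)⟩
  · rintro M _ _ _ _ vol _ V _ _ _ F _ _ _ _ _ _ K hK ω hω φ τ tr rfl rfl rfl
    have hφ := RoeTrace.isWeight_roeWeight (V := V) (F := F) (vol := vol) hK.isCompact hω
    have hτ := RoeTrace.isWeight_semicontReg hφ
    have hlsc := RoeTrace.lowerSemicontinuous_semicontReg
      (RoeTrace.roeWeight K ω : RoeTrace.PosCone (RoeTrace.almostLocal V F vol) → ℝ≥0∞)
    have hu := RoeTrace.isUnitarilyInvariant_semicontReg_roeWeight (V := V) (F := F) (vol := vol)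
      hK.isCompact hω
    have htr := RoeTrace.isWeight_semifiniteReg hτ hlsc hu
    exact ⟨hφ, hτ, hlsc, RoeTrace.isTracial_of_isUnitarilyInvariant hτ hu, htr,
      RoeTrace.lowerSemicontinuous_semifiniteReg hτ hlsc hu,
      RoeTrace.isTracial_of_isUnitarilyInvariant htr
        (RoeTrace.isUnitarilyInvariant_semifiniteReg hu),
      RoeTrace.isSemifinite_semifiniteReg hτ, RoeTrace.semifiniteReg_le hτ,
      fun a ha => RoeTrace.semifiniteReg_eq_of_lt_top hτ ha⟩
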